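/- A real random variable $X$ is said to have logarithmically concave tails if $t\mapsto \ln \mathbf{P}(|X|\ge t)$ is concave as a function from $[0,\infty)$ to $[-\infty,0]$. For a random variable $Y$ and $p\ge 1$ write $\|Y\|_p=(\mathbf{E}|Y|^p)^{1/p}$, and let $\gamma_p=\|\mathcal N(0,1)\|_p=\big(2^{p/2}\,\Gamma(\tfrac{p+1}{2})/\sqrt{\pi}\big)^{1/p}$ be the $p$-th norm of a standard Gaussian variable. Let $X_1,\dots,X_n$ be independent symmetric real random variables with logarithmically concave tails such that $\mathbf{E}X_i^2=1$ for all $i$, and let $a_1,\dots,a_n$ be real numbers with $|a_1|\ge |a_2|\ge\dots\ge |a_n|$. Then for every real $p\ge 3$ all the $X_i$ have a finite $p$-th moment, and $$\max\bigg\{\gamma_p\Big(\sum_{i\ge \lceil p/2\rceil} a_i^2\Big)^{1/2},\ \Big\|\sum_{i<p}a_iX_i\Big\|_p\bigg\}\ \le\ \Big\|\sum_{i=1}^n a_iX_i\Big\|_p\ \le\ \gamma_p\Big(\sum_{i\ge \lceil p/2\rceil} a_i^2\Big)^{1/2}+\Big\|\sum_{i<p}a_iX_i\Big\|_p ,$$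 where the sums over $i\ge\lceil p/2\rceil$ and $i<p$ extend over those $i\in\{1,\dots,n\}$ that satisfy the stated condition. -/

import Mathlib

open MeasureTheory ProbabilityTheory

noncomputable section

/-- A real random variable `X` is symmetric: `X` and `-X` have the same law. -/
def IsSymmetricRV {Ω : Type*} [MeasurableSpace Ω] (X : Ω → ℝ) (μ : Measure Ω) : Prop :=
  IdentDistrib X (fun ω => -X ω) μ μ

/-- The function `t ↦ ln P(|X| ≥ t)`, with values in the extended reals (`ln 0 = -∞`). -/
def logTail {Ω : Type*} [MeasurableSpace Ω] (X : Ω → ℝ) (μ : Measure Ω) (t : ℝ) : EReal :=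
  ENNReal.log (μ {ω | t ≤ |X ω|})

/-- `X` has logarithmically concave tails: `t ↦ ln P(|X| ≥ t)` is concave from `[0, ∞)` to
`[-∞, 0]`. Concavity is spelled out because `EReal` is not a real vector space. -/
def HasLogConcaveTails {Ω : Type*} [MeasurableSpace Ω] (X : Ω → ℝ) (μ : Measure Ω) : Prop :=
  ∀ s t u v : ℝ, 0 ≤ s → 0 ≤ t → 0 ≤ u → 0 ≤ v → u + v = 1 →
    (u : EReal) * logTail X μ s + (v : EReal) * logTail X μ t ≤ logTail X μ (u * s + v * t)

/-- `γ_p = ‖N(0,1)‖_p`, the `L_p` norm of a standard Gaussian variable. -/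
def gaussianLpNorm (p : ℝ) : ℝ :=
  lpNorm (fun x : ℝ => x) (ENNReal.ofReal p) (gaussianReal 0 1)

end

/-!
# Gaussian approximation of moments of sums of variables with logarithmically concave tails

Write `bᵢ = aᵢ ^ 2` and let `p ≥ 3`. The function `z ↦ |y + √z| ^ p + |y - √z| ^ p` is convex on
`[0, ∞)`. Hence, if two symmetric laws have the same second moment and their tails cross once, the
one with the lighter tail at infinity has the smaller `p`-th absolute moment about each point
(`lintegral_absRpow_le_of_tail_crossing`). A variable `X` of the theorem is thereby squeezed
between a random sign, whose tail drops from `1` to `0` at `1`, and the symmetric exponential law of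
variance `1`, whose tail is log-linear and so crosses the log-concave tail of `X` at most once.
Summands are replaced one at a time, by independence.

*Upper bound.* By the triangle inequality it suffices to bound the sum over `i ≥ p`, with the `Xᵢ`
replaced by symmetric exponential variables. Such a variable is `√τ g` with `τ` exponential and `g`
standard Gaussian, so the sum is a Gaussian mixture with random variance `T = ∑ bᵢ τᵢ`, and its
`p`-th moment is `γ_p ^ p E T ^ r` with `r = p / 2`. With `β = max bᵢ`, integration by parts in the
`τᵢ` gives `E T ^ r ≤ (∑ bᵢ + (r - 1) β) E T ^ (r - 1)`, and Jensen's inequality turns this into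
`‖T‖_r ≤ ∑ bᵢ + (r - 1) β` (`lintegral_expSum_rpow_le`). The indices `⌈p / 2⌉ ≤ i < p` number at
least `r - 1` and have `bᵢ ≥ β`, so they pay for the term `(r - 1) β`.

*Lower bound.* That leaving out summands decreases the norm is convexity of `|·| ^ p`. For the
Gaussian term the `Xᵢ` are replaced by random signs; `signAvg` denotes the average over the signs.
For `2 < p < 4` one has `|x| ^ p = C ∫ (cos (t x) - 1 + (t x) ^ 2 / 2) t ^ (-p - 1) dt` over
`(0, ∞)`, with `C > 0`, and the claim follows from the pointwise inequality
`exp (-∑ yᵢ ^ 2 / 2) ≤ cos x * ∏ cos yᵢ + x ^ 2 / 2` for `|yᵢ| ≤ x`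
(`exp_neg_sum_sq_le_cos_mul_prod`): the largest coefficient compensates for the difference between
random signs and Gaussian variables. The case `p ≥ 4` reduces to `p - 2`: the `p`-th moment of the
sum of signs is at least `(p - 1) ∑ bᵢ Mᵢ`, where `Mᵢ` is the moment of order `p - 2` with the
`i`-th summand left out (`signAvg_rpow_ge`), while `E |g| ^ p = (p - 1) E |g| ^ (p - 2)`. Each step
removes one more summand, whence the range `i ≥ ⌈p / 2⌉` (`gaussianMoment_le_signAvg`).
-/

/-! ### The functions `|x| ^ p` and `|x| ^ q * x` -/

/-- The function `x ↦ |x| ^ p` as an extended nonnegative real, so that its integrals need no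
integrability side conditions. -/
noncomputable def absRpow (p x : ℝ) : ENNReal := ENNReal.ofReal (|x| ^ p)

lemma measurable_absRpow (p : ℝ) : Measurable (absRpow p) := by
  unfold absRpow
  fun_prop

lemma absRpow_mul (p a x : ℝ) : absRpow p (a * x) = absRpow p a * absRpow p x := by
  rw [absRpow, abs_mul, Real.mul_rpow (abs_nonneg _) (abs_nonneg _),
    ENNReal.ofReal_mul (by positivity)]
  rfl

lemma hasDerivAt_abs_rpow_mul_self {q : ℝ} (hq : 0 < q) (x : ℝ) :
    HasDerivAt (fun x : ℝ => |x| ^ q * x) ((q + 1) * |x| ^ q) x := by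
  rcases lt_trichotomy x 0 with hx | rfl | hx
  · have h1 : HasDerivAt (fun x : ℝ => -(-x) ^ (q + 1)) ((q + 1) * |x| ^ q) x := by
      have := ((hasDerivAt_neg x).rpow_const (p := q + 1) (Or.inl (by linarith))).neg
      refine this.congr_deriv ?_
      rw [abs_of_neg hx]
      ring_nf
    refine h1.congr_of_eventuallyEq ?_
    filter_upwards [eventually_lt_nhds hx] with z hz
    rw [abs_of_neg hz, Real.rpow_add_one (by linarith)]
    ring
  · rw [hasDerivAt_iff_tendsto_slope]
    have h1 : Filter.Tendsto (fun z : ℝ => |z| ^ q) (nhdsWithin 0 {0}ᶜ) (nhds (|(0 : ℝ)| ^ q)) :=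
      ((continuous_abs.rpow_const fun _ => Or.inr hq.le).tendsto 0).mono_left nhdsWithin_le_nhds
    rw [abs_zero, Real.zero_rpow hq.ne'] at h1 ⊢
    rw [mul_zero]
    refine h1.congr' ?_
    filter_upwards [self_mem_nhdsWithin] with z hz
    have hz : z ≠ 0 := hz
    simp [slope_def_field, hz]
  · have h1 : HasDerivAt (fun x : ℝ => x ^ (q + 1)) ((q + 1) * |x| ^ q) x := by
      refine ((hasDerivAt_id x).rpow_const (p := q + 1) (Or.inl hx.ne')).congr_deriv ?_
      simp [abs_of_pos hx]
    refine h1.congr_of_eventuallyEq ?_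
    filter_upwards [eventually_gt_nhds hx] with z hz
    rw [abs_of_pos hz, Real.rpow_add_one hz.ne']

lemma convexOn_abs_rpow {q : ℝ} (hq : 1 ≤ q) : ConvexOn ℝ Set.univ (fun x : ℝ => |x| ^ q) := by
  refine ⟨convex_univ, fun x _ y _ u v hu hv huv => ?_⟩
  have h1 : |u • x + v • y| ≤ u * |x| + v * |y| := by
    refine (abs_add_le _ _).trans (le_of_eq ?_)
    simp [abs_mul, abs_of_nonneg hu, abs_of_nonneg hv]
  calc |u • x + v • y| ^ q ≤ (u * |x| + v * |y|) ^ q :=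
        Real.rpow_le_rpow (abs_nonneg _) h1 (by linarith)
    _ ≤ u • |x| ^ q + v • |y| ^ q :=
        (convexOn_rpow hq).2 (abs_nonneg x) (abs_nonneg y) hu hv huv

lemma abs_rpow_add_sub_mono {q : ℝ} (hq : 1 ≤ q) (y : ℝ) {s t : ℝ} (hs : 0 ≤ s) (hst : s ≤ t) :
    |y + s| ^ q + |y - s| ^ q ≤ |y + t| ^ q + |y - t| ^ q := by
  rcases hs.eq_or_lt with rfl | hs
  · have := (convexOn_abs_rpow hq).2 (Set.mem_univ (y + t)) (Set.mem_univ (y - t))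
      (show (0 : ℝ) ≤ 1 / 2 by norm_num) (show (0 : ℝ) ≤ 1 / 2 by norm_num) (by norm_num)
    simp only [smul_eq_mul] at this
    rw [show 1 / 2 * (y + t) + 1 / 2 * (y - t) = y by ring] at this
    simp only [add_zero, sub_zero]
    linarith
  have ht : 0 < t := hs.trans_le hst
  have hu : 0 ≤ (t + s) / (2 * t) := by positivity
  have hv : 0 ≤ (t - s) / (2 * t) := div_nonneg (by linarith) (by linarith)
  have huv : (t + s) / (2 * t) + (t - s) / (2 * t) = 1 := by field_simp; ring
  have h1 := (convexOn_abs_rpow hq).2 (Set.mem_univ (y + t)) (Set.mem_univ (y - t)) hu hv huv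
  have h2 := (convexOn_abs_rpow hq).2 (Set.mem_univ (y + t)) (Set.mem_univ (y - t)) hv hu
    (by rw [add_comm, huv])
  simp only [smul_eq_mul] at h1 h2
  rw [show (t + s) / (2 * t) * (y + t) + (t - s) / (2 * t) * (y - t) = y + s by
    field_simp; ring] at h1
  rw [show (t - s) / (2 * t) * (y + t) + (t + s) / (2 * t) * (y - t) = y - s by
    field_simp; ring] at h2
  calc _ ≤ _ := add_le_add h1 h2
    _ = ((t + s) / (2 * t) + (t - s) / (2 * t)) * (|y + t| ^ q + |y - t| ^ q) := by ring
    _ = _ := by rw [huv, one_mul]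

/-- The increment of `x ↦ |x| ^ q * x` over the interval of radius `t` around `y`. -/
noncomputable def signedIncr (q y t : ℝ) : ℝ := |y + t| ^ q * (y + t) - |y - t| ^ q * (y - t)

lemma hasDerivAt_signedIncr {q : ℝ} (hq : 0 < q) (y t : ℝ) :
    HasDerivAt (signedIncr q y) ((q + 1) * (|y + t| ^ q + |y - t| ^ q)) t := by
  have h1 := (hasDerivAt_abs_rpow_mul_self hq (y + t)).comp_const_add y t
  have h2 := (hasDerivAt_abs_rpow_mul_self hq (y - t)).comp_const_sub y t
  exact (h1.sub h2).congr_deriv (by ring)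

lemma continuous_signedIncr {q : ℝ} (hq : 0 < q) (y : ℝ) : Continuous (signedIncr q y) :=
  continuous_iff_continuousAt.2 fun t => (hasDerivAt_signedIncr hq y t).continuousAt

lemma signedIncr_zero (q y : ℝ) : signedIncr q y 0 = 0 := by simp [signedIncr]

lemma convexOn_signedIncr {q : ℝ} (hq : 1 ≤ q) (y : ℝ) :
    ConvexOn ℝ (Set.Ici 0) (signedIncr q y) := by
  have hq0 : 0 < q := by linarith
  refine MonotoneOn.convexOn_of_deriv (convex_Ici 0) (continuous_signedIncr hq0 y).continuousOn
    (fun t _ => (hasDerivAt_signedIncr hq0 y t).differentiableAt.differentiableWithinAt) ?_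
  rw [interior_Ici]
  intro s hs t _ hst
  rw [(hasDerivAt_signedIncr hq0 y s).deriv, (hasDerivAt_signedIncr hq0 y t).deriv]
  exact mul_le_mul_of_nonneg_left (abs_rpow_add_sub_mono hq y (le_of_lt hs) hst) (by linarith)

lemma le_signedIncr {q : ℝ} (hq : 1 ≤ q) (y : ℝ) {t : ℝ} (ht : 0 ≤ t) :
    2 * (q + 1) * |y| ^ q * t ≤ signedIncr q y t := by
  rcases ht.eq_or_lt with rfl | ht
  · simp [signedIncr_zero]
  have h := (convexOn_signedIncr hq y).le_slope_of_hasDerivAt (Set.mem_Ici.2 le_rfl)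
    (Set.mem_Ici.2 ht.le) ht (hasDerivAt_signedIncr (by linarith) y 0)
  rw [slope_def_field, signedIncr_zero, le_div_iff₀ (by linarith)] at h
  simp only [add_zero, sub_zero] at h
  linarith

lemma signedIncr_nonneg {q : ℝ} (hq : 1 ≤ q) (y : ℝ) {t : ℝ} (ht : 0 ≤ t) :
    0 ≤ signedIncr q y t :=
  le_trans (by positivity) (le_signedIncr hq y ht)

/-- `t ↦ signedIncr q y t / t` is nondecreasing, because `signedIncr q y` is convex and vanishes
at `0`. This is the convexity of `z ↦ |y + √z| ^ p + |y - √z| ^ p` for `p = q + 2 ≥ 3`. -/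
lemma signedIncr_div_mono {q : ℝ} (hq : 1 ≤ q) (y : ℝ) {s t : ℝ} (hs : 0 ≤ s) (hst : s ≤ t) :
    signedIncr q y s / s ≤ signedIncr q y t / t := by
  rcases hs.eq_or_lt with rfl | hs
  · simpa using div_nonneg (signedIncr_nonneg hq y hst) hst
  have ht : 0 < t := hs.trans_le hst
  have h := (convexOn_signedIncr hq y).2 (Set.mem_Ici.2 ht.le) (Set.mem_Ici.2 le_rfl)
    (show 0 ≤ s / t by positivity) (show 0 ≤ 1 - s / t by
      rw [sub_nonneg, div_le_one ht]; exact hst) (by ring)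
  simp only [smul_eq_mul, mul_zero, add_zero, signedIncr_zero, div_mul_cancel₀ _ ht.ne'] at h
  rw [div_le_iff₀ hs]
  calc signedIncr q y s ≤ _ := h
    _ = _ := by ring

lemma integral_signedIncr {p : ℝ} (hp : 2 < p) (y t : ℝ) :
    ∫ u in 0..t, p / 2 * signedIncr (p - 2) y u =
      (|y + t| ^ p + |y - t| ^ p) / 2 - |y| ^ p := by
  have hd : ∀ u ∈ Set.uIcc 0 t, HasDerivAt (fun u => (|y + u| ^ p + |y - u| ^ p) / 2)
      (p / 2 * signedIncr (p - 2) y u) u := by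
    intro u _
    have h1 := (hasDerivAt_abs_rpow (y + u) (show 1 < p by linarith)).comp_const_add y u
    have h2 := (hasDerivAt_abs_rpow (y - u) (show 1 < p by linarith)).comp_const_sub y u
    refine ((h1.add h2).div_const 2).congr_deriv ?_
    simp only [signedIncr]
    ring
  rw [intervalIntegral.integral_eq_sub_of_hasDerivAt hd
    ((continuous_const.mul (continuous_signedIncr (by linarith) y)).intervalIntegrable _ _)]
  simp

/-! ### Comparison of symmetric laws with crossing tails -/

lemma lintegral_eq_lintegral_symm {ν : Measure ℝ} (hν : ν.map (fun x => -x) = ν)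
    {f : ℝ → ENNReal} (hf : Measurable f) :
    ∫⁻ x, f x ∂ν = ∫⁻ x, (f x + f (-x)) / 2 ∂ν := by
  have h1 : ∫⁻ x, f (-x) ∂ν = ∫⁻ x, f x ∂ν := by
    conv_rhs => rw [← hν]
    rw [lintegral_map hf measurable_neg]
  simp_rw [div_eq_mul_inv]
  have hm : Measurable fun x => f x + f (-x) := hf.add (hf.comp measurable_neg)
  rw [lintegral_mul_const _ hm, lintegral_add_left hf, h1,
    ← two_mul, mul_comm, ← mul_assoc, ENNReal.inv_mul_cancel (by norm_num) (by norm_num), one_mul]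

lemma ofReal_avg_abs_rpow (p x y : ℝ) :
    (absRpow p x + absRpow p y) / 2 = ENNReal.ofReal ((|x| ^ p + |y| ^ p) / 2) := by
  rw [absRpow, absRpow, ← ENNReal.ofReal_add (by positivity) (by positivity),
    ENNReal.ofReal_div_of_pos (by norm_num)]
  simp

/-- A symmetric law spreads out `|·| ^ p`, as `|·| ^ p` is convex. -/
lemma absRpow_le_lintegral {ν : Measure ℝ} [IsProbabilityMeasure ν]
    (hν : ν.map (fun x => -x) = ν) {p : ℝ} (hp : 1 ≤ p) (y a : ℝ) :
    absRpow p y ≤ ∫⁻ x, absRpow p (y + a * x) ∂ν := by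
  have hm : Measurable fun x => absRpow p (y + a * x) :=
    (measurable_absRpow p).comp (by fun_prop)
  rw [lintegral_eq_lintegral_symm hν hm]
  calc absRpow p y = ∫⁻ _, absRpow p y ∂ν := by simp
    _ ≤ _ := lintegral_mono fun x => ?_
  rw [ofReal_avg_abs_rpow]
  refine ENNReal.ofReal_le_ofReal ?_
  have := (convexOn_abs_rpow hp).2 (Set.mem_univ (y + a * x)) (Set.mem_univ (y + a * -x))
      (show (0 : ℝ) ≤ 1 / 2 by norm_num) (show (0 : ℝ) ≤ 1 / 2 by norm_num) (by norm_num)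
  simp only [smul_eq_mul] at this
  rw [show 1 / 2 * (y + a * x) + 1 / 2 * (y + a * -x) = y by ring] at this
  linarith

/-- The layer cake formula for the `p`-th absolute moment of a shifted symmetric law. -/
lemma lintegral_absRpow_add_eq {ν : Measure ℝ} [IsProbabilityMeasure ν]
    (hν : ν.map (fun x => -x) = ν) {p : ℝ} (hp : 3 ≤ p) (y : ℝ) :
    ∫⁻ x, absRpow p (y + x) ∂ν = absRpow p y +
      ∫⁻ t in Set.Ioi 0, ν {x | t ≤ |x|} * ENNReal.ofReal (p / 2 * signedIncr (p - 2) y t) := by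
  have hm : Measurable fun x => absRpow p (y + x) :=
    (measurable_absRpow p).comp (measurable_const_add y)
  rw [lintegral_eq_lintegral_symm hν hm,
    ← lintegral_comp_eq_lintegral_meas_le_mul
      (g := fun t => p / 2 * signedIncr (p - 2) y t) ν
      (Filter.Eventually.of_forall fun x => abs_nonneg x)
      continuous_abs.measurable.aemeasurable
      (fun t _ => (continuous_const.mul
        (continuous_signedIncr (by linarith) y)).intervalIntegrable _ _)
      ((ae_restrict_iff' measurableSet_Ioi).2 (Filter.Eventually.of_forall fun t ht =>
        mul_nonneg (by linarith) (signedIncr_nonneg (by linarith) y (le_of_lt ht))))]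
  have hc : absRpow p y = ∫⁻ _, absRpow p y ∂ν := by simp
  rw [hc, ← lintegral_add_left measurable_const]
  refine lintegral_congr fun x => ?_
  rw [ofReal_avg_abs_rpow, integral_signedIncr (by linarith), absRpow, ← ENNReal.ofReal_add
    (by positivity)]
  · congr 1
    rcases abs_cases x with ⟨h, _⟩ | ⟨h, _⟩ <;> rw [h] <;> ring_nf
  · have := abs_rpow_add_sub_mono (show 1 ≤ p by linarith) y le_rfl (abs_nonneg x)
    simp only [add_zero, sub_zero] at this
    linarith

lemma lintegral_sq_eq (ν : Measure ℝ) :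
    ∫⁻ x, ENNReal.ofReal (x ^ 2) ∂ν =
      ∫⁻ t in Set.Ioi 0, ν {x | t ≤ |x|} * ENNReal.ofReal (2 * t) := by
  rw [← lintegral_comp_eq_lintegral_meas_le_mul ν
      (Filter.Eventually.of_forall fun x => abs_nonneg x)
      continuous_abs.measurable.aemeasurable
      (fun t _ => (by fun_prop : Continuous fun t : ℝ => 2 * t).intervalIntegrable _ _)
      ((ae_restrict_iff' measurableSet_Ioi).2 (Filter.Eventually.of_forall fun t ht =>
        mul_nonneg (by norm_num) (le_of_lt ht)))]
  refine lintegral_congr fun x => ?_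
  rw [intervalIntegral.integral_const_mul, integral_id, sq_abs]
  congr 1
  ring

lemma measurable_measure_le_abs (ν : Measure ℝ) : Measurable fun t : ℝ => ν {x | t ≤ |x|} :=
  Antitone.measurable fun _ _ hst => measure_mono fun _ hx => le_trans hst hx

/-- The rearrangement inequality `(m - n) * (u - c * v) ≤ 0`, without subtractions. -/
lemma mul_add_mul_le_of_crossing {m n : ENNReal} (hm : m ≠ ⊤) (hn : n ≠ ⊤) {c u v : ℝ}
    (hc : 0 ≤ c) (hu : 0 ≤ u) (hv : 0 ≤ v)
    (h : n ≤ m ∧ u ≤ c * v ∨ m ≤ n ∧ c * v ≤ u) :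
    m * ENNReal.ofReal u + ENNReal.ofReal c * (n * ENNReal.ofReal v) ≤
      n * ENNReal.ofReal u + ENNReal.ofReal c * (m * ENNReal.ofReal v) := by
  lift m to NNReal using hm
  lift n to NNReal using hn
  lift c to NNReal using hc
  lift u to NNReal using hu
  lift v to NNReal using hv
  simp only [ENNReal.ofReal_coe_nnreal]
  norm_cast at h ⊢
  rw [← NNReal.coe_le_coe]
  simp only [← NNReal.coe_le_coe] at h
  push_cast at h ⊢
  rcases h with ⟨h1, h2⟩ | ⟨h1, h2⟩ <;> nlinarith

/-- If two symmetric laws have the same finite second moment and their tails cross once, then the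
law with the smaller tails near infinity has the smaller `p`-th absolute moment about each point.
The weight of the tail at `t` in the layer cake formula, divided by the corresponding weight `2 t`
for the second moment, is nondecreasing in `t`. -/
lemma lintegral_absRpow_le_of_tail_crossing {μ ν : Measure ℝ} [IsProbabilityMeasure μ]
    [IsProbabilityMeasure ν] (hμ : μ.map (fun x => -x) = μ) (hν : ν.map (fun x => -x) = ν)
    (h2 : ∫⁻ x, ENNReal.ofReal (x ^ 2) ∂μ = ∫⁻ x, ENNReal.ofReal (x ^ 2) ∂ν)
    (hfin : ∫⁻ x, ENNReal.ofReal (x ^ 2) ∂ν ≠ ⊤) {t₀ : ℝ} (ht₀ : 0 ≤ t₀)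
    (hlt : ∀ t, 0 < t → t < t₀ → ν {x | t ≤ |x|} ≤ μ {x | t ≤ |x|})
    (hgt : ∀ t, t₀ < t → μ {x | t ≤ |x|} ≤ ν {x | t ≤ |x|})
    {p : ℝ} (hp : 3 ≤ p) (y : ℝ) :
    ∫⁻ x, absRpow p (y + x) ∂μ ≤ ∫⁻ x, absRpow p (y + x) ∂ν := by
  rw [lintegral_absRpow_add_eq hμ hp, lintegral_absRpow_add_eq hν hp]
  refine add_le_add le_rfl ?_
  set g : ℝ → ℝ := fun t => p / 2 * signedIncr (p - 2) y t with hg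
  set c : ℝ := p / 4 * (signedIncr (p - 2) y t₀ / t₀) with hc
  have hc0 : 0 ≤ c := mul_nonneg (by linarith)
    (div_nonneg (signedIncr_nonneg (by linarith) y ht₀) ht₀)
  have hg0 : ∀ t, 0 < t → 0 ≤ g t := fun t ht =>
    mul_nonneg (by linarith) (signedIncr_nonneg (by linarith) y ht.le)
  have hgm : Measurable g :=
    (continuous_const.mul (continuous_signedIncr (by linarith) y)).measurable
  have hglt : ∀ t, 0 < t → t ≤ t₀ → g t ≤ c * (2 * t) := by
    intro t ht htt
    have h := signedIncr_div_mono (show 1 ≤ p - 2 by linarith) y ht.le htt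
    rw [div_le_iff₀ ht] at h
    have := mul_le_mul_of_nonneg_left h (show 0 ≤ p / 2 by linarith)
    calc g t ≤ _ := this
      _ = _ := by rw [hc]; ring
  have hggt : ∀ t, 0 < t → t₀ ≤ t → c * (2 * t) ≤ g t := by
    intro t ht htt
    have h := signedIncr_div_mono (show 1 ≤ p - 2 by linarith) y ht₀ htt
    rw [le_div_iff₀ ht] at h
    have := mul_le_mul_of_nonneg_left h (show 0 ≤ p / 2 by linarith)
    calc c * (2 * t) = _ := by rw [hc]; ring
      _ ≤ g t := this
  have key : ∀ t ∈ Set.Ioi (0 : ℝ),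
      μ {x | t ≤ |x|} * ENNReal.ofReal (g t) +
        ENNReal.ofReal c * (ν {x | t ≤ |x|} * ENNReal.ofReal (2 * t)) ≤
      ν {x | t ≤ |x|} * ENNReal.ofReal (g t) +
        ENNReal.ofReal c * (μ {x | t ≤ |x|} * ENNReal.ofReal (2 * t)) := by
    intro t ht
    have ht : 0 < t := ht
    refine mul_add_mul_le_of_crossing (measure_ne_top _ _) (measure_ne_top _ _) hc0 (hg0 t ht)
      (by positivity) ?_
    rcases lt_trichotomy t t₀ with htt | rfl | htt
    · exact Or.inl ⟨hlt t ht htt, hglt t ht htt.le⟩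
    · rcases le_total (ν {x | t ≤ |x|}) (μ {x | t ≤ |x|}) with h | h
      · exact Or.inl ⟨h, hglt t ht le_rfl⟩
      · exact Or.inr ⟨h, hggt t ht le_rfl⟩
    · exact Or.inr ⟨hgt t htt, hggt t ht htt.le⟩
  have hint := setLIntegral_mono' (μ := volume) measurableSet_Ioi key
  have hmμ := measurable_measure_le_abs μ
  have hmν := measurable_measure_le_abs ν
  have hm2 : Measurable fun t : ℝ => ENNReal.ofReal (2 * t) := by fun_prop
  have m1 : Measurable fun t : ℝ => μ {x | t ≤ |x|} * ENNReal.ofReal (g t) :=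
    hmμ.mul hgm.ennreal_ofReal
  have m2 : Measurable fun t : ℝ => ν {x | t ≤ |x|} * ENNReal.ofReal (g t) :=
    hmν.mul hgm.ennreal_ofReal
  have m3 : Measurable fun t : ℝ => μ {x | t ≤ |x|} * ENNReal.ofReal (2 * t) := hmμ.mul hm2
  have m4 : Measurable fun t : ℝ => ν {x | t ≤ |x|} * ENNReal.ofReal (2 * t) := hmν.mul hm2
  rw [lintegral_add_left m1, lintegral_add_left m2, lintegral_const_mul _ m3,
    lintegral_const_mul _ m4,
    ← lintegral_sq_eq, ← lintegral_sq_eq, h2] at hint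
  exact (ENNReal.add_le_add_iff_right (ENNReal.mul_ne_top ENNReal.ofReal_ne_top hfin)).1 hint
/-! ### The exponential law -/

lemma expMeasure_one_eq :
    expMeasure 1 =
      (volume.restrict (Set.Ioi 0)).withDensity fun x => ENNReal.ofReal (Real.exp (-x)) := by
  have h : expMeasure 1 = volume.withDensity (exponentialPDF 1) := rfl
  have h2 : exponentialPDF 1 =
      (Set.Ici 0).indicator fun x => ENNReal.ofReal (Real.exp (-x)) := by
    ext x
    rcases lt_or_ge x 0 with hx | hx
    · rw [exponentialPDF_of_neg hx, Set.indicator_of_notMem (by simpa using hx)]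
    · rw [exponentialPDF_of_nonneg hx, Set.indicator_of_mem (by simpa using hx)]
      simp
  rw [h, h2, withDensity_indicator measurableSet_Ici, restrict_Ioi_eq_restrict_Ici]

lemma expMeasure_one_Ici {t : ℝ} (ht : 0 ≤ t) :
    expMeasure 1 {x | t ≤ x} = ENNReal.ofReal (Real.exp (-t)) := by
  have h1 : ∫ x in Set.Ioi t, Real.exp (-x) = Real.exp (-t) := integral_exp_neg_Ioi t
  have h2 : volume.restrict (Set.Ici t ∩ Set.Ioi 0) = volume.restrict (Set.Ioi t) := by
    rcases ht.eq_or_lt with rfl | ht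
    · rw [Set.inter_eq_right.2 Set.Ioi_subset_Ici_self]
    · rw [Set.inter_eq_left.2 (show Set.Ici t ⊆ Set.Ioi 0 from fun x hx => ht.trans_le hx),
        restrict_Ioi_eq_restrict_Ici]
  have h3 : {x : ℝ | t ≤ x} = Set.Ici t := rfl
  rw [expMeasure_one_eq, h3, withDensity_apply _ measurableSet_Ici,
    Measure.restrict_restrict measurableSet_Ici, h2,
    ← ofReal_integral_eq_lintegral_ofReal (integrableOn_exp_neg_Ioi t)
      (Filter.Eventually.of_forall fun x => (Real.exp_pos _).le), h1]

instance isProbabilityMeasure_expMeasure_one : IsProbabilityMeasure (expMeasure 1) :=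
  isProbabilityMeasure_expMeasure one_pos

lemma ae_pos_expMeasure_one : ∀ᵐ x ∂(expMeasure 1), 0 < x := by
  rw [expMeasure_one_eq]
  exact (withDensity_absolutelyContinuous _ _).ae_le (ae_restrict_mem measurableSet_Ioi)

lemma integral_expMeasure_one (f : ℝ → ℂ) :
    ∫ x, f x ∂(expMeasure 1) = ∫ x : ℝ in Set.Ioi 0, Complex.exp (-x) * f x := by
  rw [expMeasure_one_eq, integral_withDensity_eq_integral_toReal_smul (by fun_prop) (by simp)]
  refine integral_congr_ae (Filter.Eventually.of_forall fun x => ?_)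
  simp [ENNReal.toReal_ofReal (Real.exp_pos _).le]

/-- Integration by parts against the exponential law: `E G(τ) = E G'(τ)` when `G(0) = 0` and
`G' ≥ 0`. -/
lemma lintegral_expMeasure_one_of_deriv {G g : ℝ → ℝ} (hG : ContinuousOn G (Set.Ici 0))
    (hG0 : G 0 = 0) (hd : ∀ x, 0 < x → HasDerivAt G (g x) x) (hg : ∀ x, 0 < x → 0 ≤ g x) :
    ∫⁻ x, ENNReal.ofReal (G x) ∂(expMeasure 1) = ∫⁻ x, ENNReal.ofReal (g x) ∂(expMeasure 1) := by
  have hint : ∀ t > 0, IntervalIntegrable g volume 0 t := fun t ht =>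
    (intervalIntegrable_iff_integrableOn_Ioc_of_le ht.le).2
      (intervalIntegral.integrableOn_deriv_of_nonneg
        (hG.mono Set.Icc_subset_Ici_self)
        (fun x hx => hd x hx.1) (fun x hx => hg x hx.1))
  have h1 := lintegral_comp_eq_lintegral_meas_le_mul (f := fun x => x) (g := g) (expMeasure 1)
    (ae_pos_expMeasure_one.mono fun x hx => hx.le) measurable_id.aemeasurable hint
    ((ae_restrict_iff' measurableSet_Ioi).2 (Filter.Eventually.of_forall fun t ht => hg t ht))
  have h2 : ∫⁻ x, ENNReal.ofReal (∫ t in 0..x, g t) ∂(expMeasure 1) =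
      ∫⁻ x, ENNReal.ofReal (G x) ∂(expMeasure 1) := by
    refine lintegral_congr_ae (ae_pos_expMeasure_one.mono fun x hx => ?_)
    simp only
    rw [intervalIntegral.integral_eq_sub_of_hasDerivAt_of_le hx.le
      (hG.mono Set.Icc_subset_Ici_self) (fun t ht => hd t ht.1) (hint x hx), hG0, sub_zero]
  rw [← h2, h1]
  conv_rhs => rw [expMeasure_one_eq]
  rw [lintegral_withDensity_eq_lintegral_mul_non_measurable _ (by fun_prop) (by simp)]
  refine setLIntegral_congr_fun measurableSet_Ioi fun t ht => ?_
  simp only [Pi.mul_apply]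
  rw [expMeasure_one_Ici (le_of_lt ht)]

lemma lintegral_id_expMeasure_one : ∫⁻ x, ENNReal.ofReal x ∂(expMeasure 1) = 1 := by
  rw [lintegral_expMeasure_one_of_deriv (G := fun x => x) (g := fun _ => 1) continuousOn_id rfl
    (fun x _ => hasDerivAt_id x) (fun _ _ => zero_le_one)]
  simp

/-! ### The symmetric exponential law as a Gaussian mixture -/

/-- The law of `√τ g` for independent `τ` and `g`, where `τ` is exponential and `g` is standard
Gaussian. It is the symmetric exponential law of variance `1`. -/
noncomputable def laplaceLaw : Measure ℝ :=
  ((expMeasure 1).prod (gaussianReal 0 1)).map fun z => √z.1 * z.2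

lemma measurable_sqrt_mul : Measurable fun z : ℝ × ℝ => √z.1 * z.2 := by fun_prop

instance isProbabilityMeasure_laplaceLaw : IsProbabilityMeasure laplaceLaw :=
  Measure.isProbabilityMeasure_map measurable_sqrt_mul.aemeasurable

lemma lintegral_laplaceLaw {f : ℝ → ENNReal} (hf : Measurable f) :
    ∫⁻ x, f x ∂laplaceLaw = ∫⁻ t, ∫⁻ x, f (√t * x) ∂(gaussianReal 0 1) ∂(expMeasure 1) := by
  have hm : Measurable fun z : ℝ × ℝ => f (√z.1 * z.2) := hf.comp measurable_sqrt_mul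
  rw [laplaceLaw, lintegral_map hf measurable_sqrt_mul, lintegral_prod _ hm.aemeasurable]

lemma gaussianReal_map_neg_eq : (gaussianReal 0 1).map (fun x => -x) = gaussianReal 0 1 := by
  simpa using gaussianReal_map_neg (μ := 0) (v := 1)

lemma laplaceLaw_map_neg : laplaceLaw.map (fun x => -x) = laplaceLaw := by
  have h : ((expMeasure 1).prod (gaussianReal 0 1)).map (Prod.map id fun x => -x) =
      (expMeasure 1).prod (gaussianReal 0 1) := by
    rw [← Measure.map_prod_map _ _ measurable_id measurable_neg, Measure.map_id,
      gaussianReal_map_neg_eq]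
  rw [laplaceLaw, Measure.map_map measurable_neg measurable_sqrt_mul]
  conv_rhs => rw [← h]
  rw [Measure.map_map measurable_sqrt_mul (measurable_id.prodMap measurable_neg)]
  congr 1
  ext z
  simp

lemma lintegral_sq_gaussianReal : ∫⁻ x, ENNReal.ofReal (x ^ 2) ∂(gaussianReal 0 1) = 1 := by
  have h := variance_fun_id_gaussianReal (μ := 0) (v := 1)
  rw [variance_of_integral_eq_zero (by fun_prop) (by simp)] at h
  rw [← ofReal_integral_eq_lintegral_ofReal _ (Filter.Eventually.of_forall fun x => sq_nonneg x), h]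
  · simp
  · exact (memLp_id_gaussianReal 2).integrable_sq

lemma lintegral_sq_laplaceLaw : ∫⁻ x, ENNReal.ofReal (x ^ 2) ∂laplaceLaw = 1 := by
  rw [lintegral_laplaceLaw (by fun_prop), ← lintegral_id_expMeasure_one]
  refine lintegral_congr_ae (ae_pos_expMeasure_one.mono fun t ht => ?_)
  simp only [mul_pow, Real.sq_sqrt ht.le]
  simp_rw [ENNReal.ofReal_mul ht.le]
  rw [lintegral_const_mul _ (by fun_prop), lintegral_sq_gaussianReal, mul_one]

lemma charFun_laplaceLaw (u : ℝ) : charFun laplaceLaw u = 1 / (1 + u ^ 2 / 2) := by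
  have hm : Measurable fun z : ℝ × ℝ => Complex.exp (u * (√z.1 * z.2 : ℝ) * Complex.I) := by
    fun_prop
  rw [charFun_apply_real, laplaceLaw, integral_map measurable_sqrt_mul.aemeasurable
    (by fun_prop), integral_prod]
  · have h1 : ∀ t : ℝ, 0 < t → ∫ x, Complex.exp (u * (√t * x : ℝ) * Complex.I)
        ∂(gaussianReal 0 1) = Complex.exp (-(u ^ 2 / 2) * t) := by
      intro t ht
      have := charFun_gaussianReal (μ := 0) (v := 1) (u * √t)
      rw [charFun_apply_real] at this
      convert this using 1
      · congr 1
        ext x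
        push_cast
        ring_nf
      · congr 1
        push_cast
        have : (√t : ℂ) ^ 2 = t := by
          rw [← Complex.ofReal_pow, Real.sq_sqrt ht.le]
        rw [mul_pow, this]
        ring
    rw [integral_congr_ae (ae_pos_expMeasure_one.mono fun t ht => h1 t ht),
      integral_expMeasure_one]
    have h2 : ∀ t : ℝ, Complex.exp (-t) * Complex.exp (-(u ^ 2 / 2) * t) =
        Complex.exp (-(1 + u ^ 2 / 2) * t) := by
      intro t
      rw [← Complex.exp_add]
      ring_nf
    simp_rw [h2]
    rw [integral_exp_mul_complex_Ioi]
    · rw [Complex.ofReal_zero, mul_zero, Complex.exp_zero, neg_div_neg_eq]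
    · have : (-(1 + (u : ℂ) ^ 2 / 2)) = ((-(1 + u ^ 2 / 2) : ℝ) : ℂ) := by push_cast; ring
      rw [this, Complex.ofReal_re]
      nlinarith [sq_nonneg u]
  · refine Integrable.of_bound hm.aestronglyMeasurable 1 (Filter.Eventually.of_forall fun z => ?_)
    rw [← Complex.ofReal_mul, Complex.norm_exp_ofReal_mul_I]

lemma integrable_exp_neg_mul_abs {c : ℝ} (hc : 0 < c) :
    Integrable fun x : ℝ => Real.exp (-(c * |x|)) := by
  rw [← integrableOn_univ, ← Set.Iic_union_Ioi (a := (0 : ℝ)), integrableOn_union]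
  constructor
  · refine (integrableOn_exp_mul_Iic hc 0).congr_fun (fun x hx => ?_) measurableSet_Iic
    simp [abs_of_nonpos (Set.mem_Iic.1 hx)]
  · refine (integrableOn_exp_mul_Ioi (a := -c) (by linarith) 0).congr_fun (fun x hx => ?_)
      measurableSet_Ioi
    simp [abs_of_pos (Set.mem_Ioi.1 hx)]

lemma laplaceLaw_eq_withDensity :
    laplaceLaw =
      volume.withDensity fun x => ENNReal.ofReal (√2 / 2 * Real.exp (-(√2 * |x|))) := by
  have h2 : (0 : ℝ) < √2 := by positivity
  have hi := (integrable_exp_neg_mul_abs h2).const_mul (√2 / 2)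
  have : IsFiniteMeasure
      (volume.withDensity fun x => ENNReal.ofReal (√2 / 2 * Real.exp (-(√2 * |x|)))) :=
    isFiniteMeasure_withDensity_ofReal hi.2
  refine Measure.ext_of_charFun (funext fun u => ?_)
  rw [charFun_laplaceLaw, charFun_apply_real,
    integral_withDensity_eq_integral_toReal_smul (by fun_prop) (by simp)]
  have hI : Integrable fun x : ℝ =>
      (ENNReal.ofReal (√2 / 2 * Real.exp (-(√2 * |x|)))).toReal • Complex.exp (u * x * Complex.I) := by
    have := hi.ofReal (𝕜 := ℂ)
    refine this.mono (by fun_prop) (Filter.Eventually.of_forall fun x => ?_)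
    rw [norm_smul, ← Complex.ofReal_mul, Complex.norm_exp_ofReal_mul_I, mul_one,
      ENNReal.toReal_ofReal (by positivity), RCLike.norm_ofReal, Real.norm_eq_abs]
  have e1 : ∫ x in Set.Iic (0 : ℝ), (ENNReal.ofReal (√2 / 2 * Real.exp (-(√2 * |x|)))).toReal •
      Complex.exp (u * x * Complex.I) = (√2 / 2 : ℂ) * (1 / (√2 + u * Complex.I)) := by
    have : ∀ x ∈ Set.Iic (0 : ℝ), (ENNReal.ofReal (√2 / 2 * Real.exp (-(√2 * |x|)))).toReal •
        Complex.exp (u * x * Complex.I) =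
        (√2 / 2 : ℂ) * Complex.exp ((√2 + u * Complex.I) * x) := by
      intro x hx
      rw [ENNReal.toReal_ofReal (by positivity), abs_of_nonpos hx, Complex.real_smul]
      push_cast
      rw [mul_assoc, ← Complex.exp_add]
      ring_nf
    rw [setIntegral_congr_fun measurableSet_Iic this, integral_const_mul,
      integral_exp_mul_complex_Iic (by simp)]
    simp
  have e2 : ∫ x in Set.Ioi (0 : ℝ), (ENNReal.ofReal (√2 / 2 * Real.exp (-(√2 * |x|)))).toReal •
      Complex.exp (u * x * Complex.I) = (√2 / 2 : ℂ) * (1 / (√2 - u * Complex.I)) := by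
    have : ∀ x ∈ Set.Ioi (0 : ℝ), (ENNReal.ofReal (√2 / 2 * Real.exp (-(√2 * |x|)))).toReal •
        Complex.exp (u * x * Complex.I) =
        (√2 / 2 : ℂ) * Complex.exp (-(√2 - u * Complex.I) * x) := by
      intro x hx
      rw [ENNReal.toReal_ofReal (by positivity), abs_of_pos hx, Complex.real_smul]
      push_cast
      rw [mul_assoc, ← Complex.exp_add]
      ring_nf
    rw [setIntegral_congr_fun measurableSet_Ioi this, integral_const_mul,
      integral_exp_mul_complex_Ioi (by simp)]
    rw [Complex.ofReal_zero, mul_zero, Complex.exp_zero, neg_div_neg_eq]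
  rw [← intervalIntegral.integral_Iic_add_Ioi (b := 0) hI.integrableOn hI.integrableOn, e1, e2]
  have hs : (√2 : ℂ) ^ 2 = 2 := by
    rw [← Complex.ofReal_pow, Real.sq_sqrt (by norm_num)]
    simp
  have n1 : (√2 + u * Complex.I : ℂ) ≠ 0 := fun h => by
    have := congrArg Complex.re h
    simp at this
  have n2 : (√2 - u * Complex.I : ℂ) ≠ 0 := fun h => by
    have := congrArg Complex.re h
    simp at this
  have n3 : (1 + (u : ℂ) ^ 2 / 2) ≠ 0 := fun h => by
    have h3 : (1 + (u : ℂ) ^ 2 / 2) = ((1 + u ^ 2 / 2 : ℝ) : ℂ) := by push_cast; ring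
    rw [h3] at h
    have := Complex.ofReal_eq_zero.1 h
    nlinarith [sq_nonneg u]
  have hprod : (√2 + u * Complex.I : ℂ) * (√2 - u * Complex.I) = 2 + u ^ 2 := by
    linear_combination hs - (u : ℂ) ^ 2 * Complex.I_sq
  rw [← mul_add, div_add_div _ _ n1 n2, hprod]
  have n4 : (2 + (u : ℂ) ^ 2) ≠ 0 := hprod ▸ mul_ne_zero n1 n2
  field_simp
  linear_combination (-2) * hs

lemma laplaceLaw_tail {t : ℝ} (ht : 0 ≤ t) :
    laplaceLaw {x | t ≤ |x|} = ENNReal.ofReal (Real.exp (-(√2 * t))) := by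
  have h2 : (0 : ℝ) < √2 := by positivity
  have hset : {x : ℝ | t ≤ |x|} = Set.Iic (-t) ∪ Set.Ici t := by
    ext x
    simp [le_abs, le_neg, or_comm]
  have hres : volume.restrict {x : ℝ | t ≤ |x|} = volume.restrict (Set.Iic (-t) ∪ Set.Ioi t) := by
    rw [hset]
    exact Measure.restrict_congr_set ((ae_eq_refl _).union Ioi_ae_eq_Ici.symm)
  have hi := (integrable_exp_neg_mul_abs h2).const_mul (√2 / 2)
  have hs : MeasurableSet {x : ℝ | t ≤ |x|} := measurableSet_le measurable_const (by fun_prop)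
  rw [laplaceLaw_eq_withDensity, withDensity_apply _ hs, hres,
    ← ofReal_integral_eq_lintegral_ofReal hi.integrableOn
      (Filter.Eventually.of_forall fun x => by positivity)]
  congr 1
  rw [setIntegral_union (by
      rw [Set.disjoint_left]
      intro x hx hx'
      have := Set.mem_Iic.1 hx
      have := Set.mem_Ioi.1 hx'
      linarith) measurableSet_Ioi hi.integrableOn hi.integrableOn]
  have e1 : ∫ x in Set.Iic (-t), √2 / 2 * Real.exp (-(√2 * |x|)) =
      √2 / 2 * (Real.exp (√2 * (-t)) / √2) := by
    rw [← integral_exp_mul_Iic h2, ← integral_const_mul]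
    refine setIntegral_congr_fun measurableSet_Iic fun x hx => ?_
    have hx := Set.mem_Iic.1 hx
    simp [abs_of_nonpos (show x ≤ 0 by linarith)]
  have e2 : ∫ x in Set.Ioi t, √2 / 2 * Real.exp (-(√2 * |x|)) =
      √2 / 2 * (-Real.exp (-√2 * t) / -√2) := by
    rw [← integral_exp_mul_Ioi (by linarith), ← integral_const_mul]
    refine setIntegral_congr_fun measurableSet_Ioi fun x hx => ?_
    have hx := Set.mem_Ioi.1 hx
    simp [abs_of_pos (show 0 < x by linarith)]
  rw [e1, e2, neg_div_neg_eq, neg_mul, mul_neg]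
  field_simp
  ring
/-! ### Weighted sums of independent variables -/

lemma lintegral_indep_weighted_sum {ι Ω : Type*} [MeasurableSpace Ω] {μ : Measure Ω}
    [IsProbabilityMeasure μ] {X : ι → Ω → ℝ} (hmeas : ∀ i, Measurable (X i))
    (hindep : iIndepFun X μ) (a : ι → ℝ) {s : Finset ι} {i : ι} (hi : i ∉ s)
    {F : ℝ × ℝ → ENNReal} (hF : Measurable F) :
    ∫⁻ ω, F (∑ j ∈ s, a j * X j ω, X i ω) ∂μ =
      ∫⁻ ω, ∫⁻ x, F (∑ j ∈ s, a j * X j ω, x) ∂(μ.map (X i)) ∂μ := by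
  classical
  have hS : Measurable fun ω => ∑ j ∈ s, a j * X j ω :=
    Finset.measurable_fun_sum _ fun j _ => (hmeas j).const_mul _
  have hind : IndepFun (fun ω => ∑ j ∈ s, a j * X j ω) (X i) μ := by
    have h := hindep.indepFun_finset s {i} (Finset.disjoint_singleton_right.2 hi) hmeas
    have h1 : Measurable fun z : s → ℝ => ∑ j : s, a j * z j := by fun_prop
    have h2 : Measurable fun z : ({i} : Finset ι) → ℝ => z ⟨i, Finset.mem_singleton_self i⟩ := by
      fun_prop
    convert h.comp h1 h2 using 1
    · ext ω
      simp only [Function.comp]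
      rw [Finset.sum_coe_sort s fun j => a j * X j ω]
    · rfl
  have hmap := (indepFun_iff_map_prod_eq_prod_map_map hS.aemeasurable (hmeas i).aemeasurable).1 hind
  have := Measure.isProbabilityMeasure_map (μ := μ) (hmeas i).aemeasurable
  calc ∫⁻ ω, F (∑ j ∈ s, a j * X j ω, X i ω) ∂μ
      = ∫⁻ z, F z ∂(μ.map fun ω => (∑ j ∈ s, a j * X j ω, X i ω)) := by
        rw [lintegral_map hF (hS.prodMk (hmeas i))]
    _ = _ := by
        rw [hmap, lintegral_prod _ hF.aemeasurable,
          lintegral_map (Measurable.lintegral_prod_right' hF) hS]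

/-! ### Moments of weighted sums of exponential variables -/

lemma lintegral_expMeasure_one_mul_rpow {b c k : ℝ} (hb : 0 < b) (hc : 0 ≤ c) (hk : 0 < k) :
    ∫⁻ x, ENNReal.ofReal (x * (c + b * x) ^ k) ∂(expMeasure 1) =
      ∫⁻ x, ENNReal.ofReal ((c + b * x) ^ k + k * (b * x) * (c + b * x) ^ (k - 1))
        ∂(expMeasure 1) := by
  have hpos : ∀ x, 0 < x → 0 < c + b * x := fun x hx => by positivity
  refine lintegral_expMeasure_one_of_deriv ?_ (by simp) (fun x hx => ?_) (fun x hx => ?_)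
  · exact (continuous_id.mul ((by fun_prop : Continuous fun x : ℝ => c + b * x).rpow_const
      fun _ => Or.inr hk.le)).continuousOn
  · have h1 : HasDerivAt (fun x : ℝ => c + b * x) b x := by
      simpa using ((hasDerivAt_id x).const_mul b).const_add c
    refine ((hasDerivAt_id x).mul (h1.rpow_const (p := k) (Or.inl (hpos x hx).ne'))).congr_deriv ?_
    simp only [id]
    ring
  · have := (hpos x hx).le
    positivity

/-- For a sum `T = ∑ bᵢ τᵢ` with `τᵢ` exponential and `bᵢ ≤ β`, integration by parts in each `τᵢ`
bounds the ratio of consecutive moments: `E T ^ (k + 1) ≤ (∑ bᵢ + k β) E T ^ k`. -/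
lemma lintegral_expSum_rpow_succ_le {ι Ω : Type*} [MeasurableSpace Ω] {P : Measure Ω}
    [IsProbabilityMeasure P] {τ : ι → Ω → ℝ} (hmeas : ∀ i, Measurable (τ i))
    (hindep : iIndepFun τ P) (hlaw : ∀ i, P.map (τ i) = expMeasure 1)
    {b : ι → ℝ} (hb : ∀ i, 0 ≤ b i) {s : Finset ι} {β : ℝ} (hβ : ∀ i ∈ s, b i ≤ β)
    {k : ℝ} (hk : 0 < k) :
    ∫⁻ ω, ENNReal.ofReal ((∑ i ∈ s, b i * τ i ω) ^ (k + 1)) ∂P ≤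
      ENNReal.ofReal (∑ i ∈ s, b i + k * β) *
        ∫⁻ ω, ENNReal.ofReal ((∑ i ∈ s, b i * τ i ω) ^ k) ∂P := by
  classical
  set T : Ω → ℝ := fun ω => ∑ i ∈ s, b i * τ i ω with hT
  have hTm : Measurable T := Finset.measurable_fun_sum _ fun j _ => (hmeas j).const_mul _
  have hτ : ∀ i, ∀ᵐ ω ∂P, 0 < τ i ω := fun i => by
    have := ae_pos_expMeasure_one
    rw [← hlaw i] at this
    exact ae_of_ae_map (hmeas i).aemeasurable this
  have hτs : ∀ᵐ ω ∂P, ∀ i ∈ s, 0 < τ i ω :=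
    (ae_ball_iff s.countable_toSet).2 fun i _ => hτ i
  have hT0 : ∀ᵐ ω ∂P, 0 ≤ T ω := hτs.mono fun ω h =>
    Finset.sum_nonneg fun i hi => mul_nonneg (hb i) (h i hi).le
  have hterm : ∀ i ∈ s, ∫⁻ ω, ENNReal.ofReal (b i * (τ i ω * T ω ^ k)) ∂P =
      ∫⁻ ω, ENNReal.ofReal (b i * (T ω ^ k + k * (b i * τ i ω) * T ω ^ (k - 1))) ∂P := by
    intro i hi
    rcases (hb i).eq_or_lt with h0 | hbi
    · simp [← h0]
    have hsplit : ∀ ω, T ω = ∑ j ∈ s.erase i, b j * τ j ω + b i * τ i ω := fun ω =>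
      (Finset.sum_erase_add s _ hi).symm
    have hR0 : ∀ᵐ ω ∂P, 0 ≤ ∑ j ∈ s.erase i, b j * τ j ω := hτs.mono fun ω h =>
      Finset.sum_nonneg fun j hj => mul_nonneg (hb j) (h j (Finset.mem_of_mem_erase hj)).le
    have e1 := lintegral_indep_weighted_sum hmeas hindep b (Finset.notMem_erase i s)
      (F := fun z => ENNReal.ofReal (b i * (z.2 * (z.1 + b i * z.2) ^ k))) (by fun_prop)
    have e2 := lintegral_indep_weighted_sum hmeas hindep b (Finset.notMem_erase i s)
      (F := fun z => ENNReal.ofReal (b i * ((z.1 + b i * z.2) ^ k +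
        k * (b i * z.2) * (z.1 + b i * z.2) ^ (k - 1)))) (by fun_prop)
    simp only at e1 e2
    simp_rw [hsplit]
    rw [e1, e2, hlaw i]
    refine lintegral_congr_ae (hR0.mono fun ω hω => ?_)
    simp only [ENNReal.ofReal_mul hbi.le]
    rw [lintegral_const_mul _ (by fun_prop), lintegral_const_mul _ (by fun_prop),
      lintegral_expMeasure_one_mul_rpow hbi hω hk]
  calc ∫⁻ ω, ENNReal.ofReal (T ω ^ (k + 1)) ∂P
      = ∫⁻ ω, ∑ i ∈ s, ENNReal.ofReal (b i * (τ i ω * T ω ^ k)) ∂P := by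
        refine lintegral_congr_ae ?_
        filter_upwards [hT0, hτs] with ω h0 hpos
        rw [← ENNReal.ofReal_sum_of_nonneg fun i hi =>
          mul_nonneg (hb i) (mul_nonneg (hpos i hi).le (Real.rpow_nonneg h0 _)),
          Real.rpow_add_one' h0 (by linarith), mul_comm]
        conv_lhs => rw [hT, Finset.sum_mul]
        simp_rw [hT, mul_assoc]
    _ = ∑ i ∈ s, ∫⁻ ω, ENNReal.ofReal (b i * (τ i ω * T ω ^ k)) ∂P :=
        lintegral_finsetSum _ fun i _ => by fun_prop
    _ = ∑ i ∈ s, ∫⁻ ω,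
          ENNReal.ofReal (b i * (T ω ^ k + k * (b i * τ i ω) * T ω ^ (k - 1))) ∂P :=
        Finset.sum_congr rfl hterm
    _ = ∫⁻ ω, ∑ i ∈ s,
          ENNReal.ofReal (b i * (T ω ^ k + k * (b i * τ i ω) * T ω ^ (k - 1))) ∂P :=
        (lintegral_finsetSum _ fun i _ => by fun_prop).symm
    _ ≤ ∫⁻ ω, ENNReal.ofReal (∑ i ∈ s, b i + k * β) * ENNReal.ofReal (T ω ^ k) ∂P := by
        refine lintegral_mono_ae ?_
        filter_upwards [hT0, hτs] with ω h0 hpos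
        have hk1 : 0 ≤ T ω ^ (k - 1) := Real.rpow_nonneg h0 _
        have hk0 : 0 ≤ T ω ^ k := Real.rpow_nonneg h0 _
        have hmul : T ω * T ω ^ (k - 1) = T ω ^ k := by
          rw [mul_comm, ← Real.rpow_add_one' h0 (by rw [sub_add_cancel]; exact hk.ne'),
            sub_add_cancel]
        have hnn : ∀ i ∈ s, 0 ≤ b i * τ i ω := fun i hi => mul_nonneg (hb i) (hpos i hi).le
        rw [← ENNReal.ofReal_sum_of_nonneg fun i hi => mul_nonneg (hb i) (by
          have := hnn i hi
          positivity), ← ENNReal.ofReal_mul' hk0]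
        refine ENNReal.ofReal_le_ofReal ?_
        calc ∑ i ∈ s, b i * (T ω ^ k + k * (b i * τ i ω) * T ω ^ (k - 1))
            ≤ ∑ i ∈ s, (b i * T ω ^ k + k * β * T ω ^ (k - 1) * (b i * τ i ω)) := by
              refine Finset.sum_le_sum fun i hi => ?_
              have h1 : b i * (k * T ω ^ (k - 1) * (b i * τ i ω)) ≤
                  β * (k * T ω ^ (k - 1) * (b i * τ i ω)) :=
                mul_le_mul_of_nonneg_right (hβ i hi) (mul_nonneg (by positivity) (hnn i hi))
              linarith
          _ = (∑ i ∈ s, b i) * T ω ^ k + k * β * (T ω * T ω ^ (k - 1)) := by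
              rw [Finset.sum_add_distrib, ← Finset.sum_mul, ← Finset.mul_sum]
              simp only [hT]
              ring
          _ = (∑ i ∈ s, b i + k * β) * T ω ^ k := by rw [hmul]; ring
    _ = _ := lintegral_const_mul _ (by fun_prop)

lemma lintegral_expMeasure_one_rpow_ne_top {r : ℝ} (hr : 0 < r) :
    ∫⁻ x, ENNReal.ofReal (|x| ^ r) ∂(expMeasure 1) ≠ ⊤ := by
  have h := Real.GammaIntegral_convergent (show 0 < r + 1 by linarith)
  rw [expMeasure_one_eq,
    lintegral_withDensity_eq_lintegral_mul_non_measurable _ (by fun_prop) (by simp)]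
  have h2 := h.lintegral_lt_top.ne
  convert h2 using 1
  refine setLIntegral_congr_fun measurableSet_Ioi fun x hx => ?_
  simp [ENNReal.ofReal_mul (Real.exp_pos _).le, abs_of_pos (Set.mem_Ioi.1 hx)]

lemma memLp_ofReal_iff {Ω : Type*} [MeasurableSpace Ω] {μ : Measure Ω} {f : Ω → ℝ}
    (hf : Measurable f) {p : ℝ} (hp : 0 < p) :
    MemLp f (ENNReal.ofReal p) μ ↔ ∫⁻ ω, absRpow p (f ω) ∂μ ≠ ⊤ := by
  have h0 : ENNReal.ofReal p ≠ 0 := by simpa using hp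
  rw [MemLp, and_iff_right hf.aestronglyMeasurable,
    eLpNorm_lt_top_iff_lintegral_rpow_enorm_lt_top h0 ENNReal.ofReal_ne_top, lt_top_iff_ne_top,
    ENNReal.toReal_ofReal hp.le]
  simp_rw [absRpow, ← ENNReal.ofReal_rpow_of_nonneg (abs_nonneg _) hp.le, Real.enorm_eq_ofReal_abs]

lemma lintegral_rpow_le_rpow_lintegral {Ω : Type*} [MeasurableSpace Ω] {P : Measure Ω}
    [IsProbabilityMeasure P] {f : Ω → ENNReal} (hf : Measurable f) {k : ℝ} (hk : 0 < k) :
    ∫⁻ ω, f ω ^ k ∂P ≤ (∫⁻ ω, f ω ^ (k + 1) ∂P) ^ (k / (k + 1)) := by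
  have hpq : Real.HolderConjugate ((k + 1) / k) (k + 1) := by
    rw [Real.holderConjugate_iff]
    refine ⟨by rw [lt_div_iff₀ hk]; linarith, by field_simp⟩
  have h := ENNReal.lintegral_mul_le_Lp_mul_Lq P hpq (hf.pow_const k).aemeasurable
    (aemeasurable_const (b := (1 : ENNReal)))
  simp only [Pi.mul_apply, mul_one, ← ENNReal.rpow_mul, ENNReal.one_rpow, lintegral_const,
    measure_univ] at h
  rw [mul_div_cancel₀ _ hk.ne'] at h
  simpa using h

/-- `‖T‖_r ≤ ∑ bᵢ + (r - 1) β` for a sum `T = ∑ bᵢ τᵢ` of independent exponential variables with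
weights `bᵢ ≤ β`. -/
lemma lintegral_expSum_rpow_le {ι Ω : Type*} [MeasurableSpace Ω] {P : Measure Ω}
    [IsProbabilityMeasure P] {τ : ι → Ω → ℝ} (hmeas : ∀ i, Measurable (τ i))
    (hindep : iIndepFun τ P) (hlaw : ∀ i, P.map (τ i) = expMeasure 1)
    {b : ι → ℝ} (hb : ∀ i, 0 ≤ b i) {s : Finset ι} {β : ℝ} (hβ0 : 0 ≤ β)
    (hβ : ∀ i ∈ s, b i ≤ β) {r : ℝ} (hr : 1 < r) :
    ∫⁻ ω, ENNReal.ofReal ((∑ i ∈ s, b i * τ i ω) ^ r) ∂P ≤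
      ENNReal.ofReal ((∑ i ∈ s, b i + (r - 1) * β) ^ r) := by
  obtain ⟨k, rfl⟩ : ∃ k, r = k + 1 := ⟨r - 1, by ring⟩
  have hk : 0 < k := by linarith
  have hk1 : 0 < k + 1 := by linarith
  rw [add_sub_cancel_right]
  set C : ℝ := ∑ i ∈ s, b i + k * β with hC
  have hC0 : 0 ≤ C := add_nonneg (Finset.sum_nonneg fun i _ => hb i) (by positivity)
  have hTm : Measurable fun ω => ∑ i ∈ s, b i * τ i ω :=
    Finset.measurable_fun_sum _ fun j _ => (hmeas j).const_mul _
  have hT0 : ∀ᵐ ω ∂P, 0 ≤ ∑ i ∈ s, b i * τ i ω := by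
    have hτ : ∀ i, ∀ᵐ ω ∂P, 0 < τ i ω := fun i => by
      have := ae_pos_expMeasure_one
      rw [← hlaw i] at this
      exact ae_of_ae_map (hmeas i).aemeasurable this
    have hτs : ∀ᵐ ω ∂P, ∀ i ∈ s, 0 < τ i ω :=
      (ae_ball_iff s.countable_toSet).2 fun i _ => hτ i
    exact hτs.mono fun ω h => Finset.sum_nonneg fun i hi => mul_nonneg (hb i) (h i hi).le
  set M := ∫⁻ ω, ENNReal.ofReal ((∑ i ∈ s, b i * τ i ω) ^ (k + 1)) ∂P with hM
  have hMtop : M ≠ ⊤ := by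
    have h1 : ∀ i ∈ s, MemLp (fun ω => b i * τ i ω) (ENNReal.ofReal (k + 1)) P := by
      intro i _
      refine MemLp.const_mul ((memLp_ofReal_iff (hmeas i) hk1).2 ?_) _
      have := lintegral_expMeasure_one_rpow_ne_top hk1
      rw [← hlaw i, lintegral_map (by fun_prop) (hmeas i)] at this
      exact this
    have h2 := (memLp_ofReal_iff hTm hk1).1 (memLp_finsetSum s h1)
    convert h2 using 1
    exact lintegral_congr_ae (hT0.mono fun ω h => by simp only [absRpow, abs_of_nonneg h])
  have hJ : ∫⁻ ω, ENNReal.ofReal ((∑ i ∈ s, b i * τ i ω) ^ k) ∂P ≤ M ^ (k / (k + 1)) := by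
    have h := lintegral_rpow_le_rpow_lintegral (P := P) hTm.ennreal_ofReal hk
    rwa [lintegral_congr_ae (hT0.mono fun ω h => ENNReal.ofReal_rpow_of_nonneg h hk.le),
      lintegral_congr_ae (hT0.mono fun ω h => ENNReal.ofReal_rpow_of_nonneg h hk1.le)] at h
  have hle : M ≤ ENNReal.ofReal C * M ^ (k / (k + 1)) :=
    (lintegral_expSum_rpow_succ_le hmeas hindep hlaw hb hβ hk).trans (by gcongr)
  rcases eq_or_ne M 0 with h0 | h0
  · rw [h0]; exact zero_le
  have hroot : M ^ (1 / (k + 1)) ≤ ENNReal.ofReal C := by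
    have hsplit : M = M ^ (1 / (k + 1)) * M ^ (k / (k + 1)) := by
      rw [← ENNReal.rpow_add _ _ h0 hMtop, ← add_div, add_comm 1 k, div_self hk1.ne',
        ENNReal.rpow_one]
    refine (ENNReal.mul_le_mul_iff_left ?_ ?_).1 (hsplit.symm.trans_le hle)
    · exact (ENNReal.rpow_pos (pos_iff_ne_zero.2 h0) hMtop).ne'
    · exact ENNReal.rpow_ne_top_of_nonneg (by positivity) hMtop
  calc M = (M ^ (1 / (k + 1))) ^ (k + 1) := by
        rw [← ENNReal.rpow_mul, one_div_mul_cancel hk1.ne', ENNReal.rpow_one]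
    _ ≤ ENNReal.ofReal C ^ (k + 1) := by gcongr
    _ = _ := ENNReal.ofReal_rpow_of_nonneg hC0 hk1.le
/-! ### Comparison with the symmetric exponential law -/

/-- The normalizations that make `X` comparable with the other laws: `X` is symmetric, has
logarithmically concave tails, and `E X ^ 2 = 1`. -/
structure IsNormalizedLogConcave {Ω : Type*} [MeasurableSpace Ω] (X : Ω → ℝ) (μ : Measure Ω) :
    Prop where
  measurable : Measurable X
  symm : IsSymmetricRV X μ
  logConcave : HasLogConcaveTails X μ
  sq : ∫ ω, X ω ^ 2 ∂μ = 1

namespace IsNormalizedLogConcave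

variable {Ω : Type*} [MeasurableSpace Ω] {μ : Measure Ω} {X : Ω → ℝ}

lemma map_neg (h : IsNormalizedLogConcave X μ) : (μ.map X).map (fun x => -x) = μ.map X := by
  rw [Measure.map_map measurable_neg h.measurable]
  exact h.symm.map_eq.symm

lemma lintegral_sq (h : IsNormalizedLogConcave X μ) :
    ∫⁻ x, ENNReal.ofReal (x ^ 2) ∂(μ.map X) = 1 := by
  have hi : Integrable (fun ω => X ω ^ 2) μ := by
    by_contra hi
    have := h.sq
    rw [integral_undef hi] at this
    exact zero_ne_one this
  rw [lintegral_map (by fun_prop) h.measurable,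
    ← ofReal_integral_eq_lintegral_ofReal hi (Filter.Eventually.of_forall fun ω => sq_nonneg _),
    h.sq, ENNReal.ofReal_one]

lemma map_tail (h : IsNormalizedLogConcave X μ) (t : ℝ) :
    μ.map X {x | t ≤ |x|} = μ {ω | t ≤ |X ω|} :=
  Measure.map_apply h.measurable (measurableSet_le measurable_const (by fun_prop))

variable [IsProbabilityMeasure μ]

/-- Logarithmic concavity of the tails between `0` and `t`, where the tail at `0` is `1`. -/
lemma tail_rpow_le (h : IsNormalizedLogConcave X μ) {l t : ℝ} (hl : 0 ≤ l) (hl1 : l ≤ 1)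
    (ht : 0 ≤ t) : (μ {ω | t ≤ |X ω|}) ^ l ≤ μ {ω | l * t ≤ |X ω|} := by
  have h1 := h.logConcave 0 t (1 - l) l le_rfl ht (by linarith) hl (by ring)
  have h0 : logTail X μ 0 = 0 := by simp [logTail]
  rw [h0, mul_zero, mul_zero, zero_add, zero_add, logTail, logTail, ← ENNReal.log_rpow,
    ENNReal.log_le_log_iff] at h1
  exact h1

/-- Once the tail of `X` is below the exponential tail `exp (-c t)`, it stays below. -/
lemma tail_lt_exp (h : IsNormalizedLogConcave X μ) {c s t : ℝ} (hs : 0 < s) (hst : s ≤ t)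
    (hlt : μ {ω | s ≤ |X ω|} < ENNReal.ofReal (Real.exp (-(c * s)))) :
    μ {ω | t ≤ |X ω|} < ENNReal.ofReal (Real.exp (-(c * t))) := by
  have ht : 0 < t := hs.trans_le hst
  have h1 := h.tail_rpow_le (l := s / t) (by positivity) ((div_le_one ht).2 hst) ht.le
  rw [div_mul_cancel₀ _ ht.ne'] at h1
  have h2 := ENNReal.rpow_lt_rpow (h1.trans_lt hlt) (show 0 < t / s by positivity)
  rw [← ENNReal.rpow_mul, div_mul_div_cancel₀ ht.ne', div_self hs.ne', ENNReal.rpow_one,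
    ENNReal.ofReal_rpow_of_pos (Real.exp_pos _), ← Real.exp_mul] at h2
  convert h2 using 3
  field_simp

/-- Among the symmetric laws of variance `1` with logarithmically concave tails, the symmetric
exponential law has the largest `p`-th absolute moments about each point. -/
lemma lintegral_le_laplaceLaw (h : IsNormalizedLogConcave X μ) {p : ℝ} (hp : 3 ≤ p) (y : ℝ) :
    ∫⁻ x, absRpow p (y + x) ∂(μ.map X) ≤ ∫⁻ x, absRpow p (y + x) ∂laplaceLaw := by
  have := Measure.isProbabilityMeasure_map (μ := μ) h.measurable.aemeasurable
  have h2 : ∫⁻ x, ENNReal.ofReal (x ^ 2) ∂(μ.map X) = ∫⁻ x, ENNReal.ofReal (x ^ 2) ∂laplaceLaw := by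
    rw [h.lintegral_sq, lintegral_sq_laplaceLaw]
  have hfin : ∫⁻ x, ENNReal.ofReal (x ^ 2) ∂laplaceLaw ≠ ⊤ := by
    rw [lintegral_sq_laplaceLaw]
    exact ENNReal.one_ne_top
  by_cases hcross : ∃ t₁ > 0, μ {ω | t₁ ≤ |X ω|} < ENNReal.ofReal (Real.exp (-(√2 * t₁)))
  · set S : Set ℝ := {t | 0 < t ∧ μ {ω | t ≤ |X ω|} < ENNReal.ofReal (Real.exp (-(√2 * t)))}
      with hS
    have hSbdd : BddBelow S := ⟨0, fun t ht => ht.1.le⟩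
    have hSne : S.Nonempty := hcross
    refine lintegral_absRpow_le_of_tail_crossing h.map_neg laplaceLaw_map_neg h2 hfin
      (t₀ := sInf S) (le_csInf hSne fun t ht => ht.1.le) (fun t ht htS => ?_) (fun t ht => ?_) hp y
    · rw [h.map_tail, laplaceLaw_tail ht.le]
      by_contra hlt
      exact absurd (csInf_le hSbdd ⟨ht, not_le.1 hlt⟩) (not_le.2 htS)
    · obtain ⟨s, hs, hst⟩ := exists_lt_of_csInf_lt hSne ht
      rw [h.map_tail, laplaceLaw_tail (hs.1.trans hst).le]
      exact (h.tail_lt_exp hs.1 hst.le hs.2).le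
  · -- without a crossing, equality of the second moments forces equality of the tails
    push Not at hcross
    have hle : ∀ t > 0, laplaceLaw {x | t ≤ |x|} ≤ μ.map X {x | t ≤ |x|} := fun t ht => by
      rw [h.map_tail, laplaceLaw_tail ht.le]
      exact hcross t ht
    have hae := ae_eq_of_ae_le_of_lintegral_le
      (μ := volume.restrict (Set.Ioi (0 : ℝ)))
      (f := fun t => laplaceLaw {x | t ≤ |x|} * ENNReal.ofReal (2 * t))
      (g := fun t => μ.map X {x | t ≤ |x|} * ENNReal.ofReal (2 * t))
      ((ae_restrict_iff' measurableSet_Ioi).2 (Filter.Eventually.of_forall fun t ht =>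
        mul_le_mul_left (hle t ht) _))
      (by rw [← lintegral_sq_eq]; exact hfin)
      ((measurable_measure_le_abs _).mul (by fun_prop)).aemeasurable
      (by rw [← lintegral_sq_eq, ← lintegral_sq_eq, h2])
    rw [lintegral_absRpow_add_eq h.map_neg hp, lintegral_absRpow_add_eq laplaceLaw_map_neg hp]
    refine le_of_eq (congrArg _ (lintegral_congr_ae ?_))
    filter_upwards [hae, ae_restrict_mem measurableSet_Ioi] with t ht ht0
    have h0 : ENNReal.ofReal (2 * t) ≠ 0 := by
      simpa using ht0
    rw [(ENNReal.mul_left_inj h0 ENNReal.ofReal_ne_top).1 ht]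

end IsNormalizedLogConcave

/-- Moment comparison for variables transfers to multiples of the variables. -/
lemma lintegral_absRpow_add_mul_le {μ ν : Measure ℝ} [IsProbabilityMeasure μ]
    [IsProbabilityMeasure ν] {p : ℝ}
    (h : ∀ y, ∫⁻ x, absRpow p (y + x) ∂μ ≤ ∫⁻ x, absRpow p (y + x) ∂ν) (y a : ℝ) :
    ∫⁻ x, absRpow p (y + a * x) ∂μ ≤ ∫⁻ x, absRpow p (y + a * x) ∂ν := by
  rcases eq_or_ne a 0 with rfl | ha
  · simp
  have hx : ∀ x, absRpow p (y + a * x) = absRpow p a * absRpow p (y / a + x) := fun x => by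
    rw [← absRpow_mul]
    congr 1
    field_simp
  have hm : Measurable fun x => absRpow p (y / a + x) :=
    (measurable_absRpow p).comp (measurable_const_add _)
  simp_rw [hx]
  rw [lintegral_const_mul _ hm, lintegral_const_mul _ hm]
  exact mul_le_mul_right (h _) _

/-! ### Comparison of sums with Gaussian mixtures -/

lemma lintegral_gaussianReal_add {f : ℝ → ENNReal} (hf : Measurable f) (c d : ℝ) :
    ∫⁻ x, ∫⁻ z, f (c * x + d * z) ∂(gaussianReal 0 1) ∂(gaussianReal 0 1) =
      ∫⁻ x, f (√(c ^ 2 + d ^ 2) * x) ∂(gaussianReal 0 1) := by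
  have hmap : ∀ c : ℝ, (gaussianReal 0 1).map (fun x => c * x) =
      gaussianReal 0 (.mk (c ^ 2) (sq_nonneg c)) := fun c => by
    have := gaussianReal_map_const_mul (μ := 0) (v := 1) c
    rwa [mul_zero, mul_one] at this
  have h1 : ((gaussianReal 0 1).map fun x => c * x) ∗ ((gaussianReal 0 1).map fun x => d * x) =
      (gaussianReal 0 1).map fun x => √(c ^ 2 + d ^ 2) * x := by
    rw [hmap, hmap, hmap, gaussianReal_conv_gaussianReal, add_zero]
    congr 1
    ext
    simp [Real.sq_sqrt (add_nonneg (sq_nonneg c) (sq_nonneg d))]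
  have h2 := congrArg (fun ν => ∫⁻ x, f x ∂ν) h1
  rw [Measure.lintegral_conv hf, lintegral_map hf (by fun_prop),
    lintegral_map (by fun_prop) (by fun_prop)] at h2
  rw [← h2]
  refine lintegral_congr fun x => ?_
  rw [lintegral_map (by fun_prop) (by fun_prop)]

/-- The `p`-th absolute moment about `-y` of the centered Gaussian law of variance `v ≥ 0`. -/
noncomputable def gaussianMoment (p : ℝ) (v y : ℝ) : ENNReal :=
  ∫⁻ x, absRpow p (y + √v * x) ∂(gaussianReal 0 1)

lemma measurable_gaussianMoment (p : ℝ) :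
    Measurable fun z : ℝ × ℝ => gaussianMoment p z.1 z.2 := by
  have : Measurable fun z : (ℝ × ℝ) × ℝ => absRpow p (z.1.2 + √z.1.1 * z.2) :=
    (measurable_absRpow p).comp (by fun_prop)
  exact this.lintegral_prod_right'

lemma Measurable.gaussianMoment {α : Type*} [MeasurableSpace α] {f g : α → ℝ} (hf : Measurable f)
    (hg : Measurable g) (p : ℝ) : Measurable fun z => gaussianMoment p (f z) (g z) :=
  (measurable_gaussianMoment p).comp (hf.prodMk hg)

lemma lintegral_gaussianMoment (p : ℝ) {v t : ℝ} (hv : 0 ≤ v) (ht : 0 ≤ t) (y a : ℝ) :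
    ∫⁻ x, gaussianMoment p v (y + a * (√t * x)) ∂(gaussianReal 0 1) =
      gaussianMoment p (v + a ^ 2 * t) y := by
  have h := lintegral_gaussianReal_add (f := fun x => absRpow p (y + x))
    ((measurable_absRpow p).comp (measurable_const_add y)) (a * √t) (√v)
  rw [mul_pow, Real.sq_sqrt ht, Real.sq_sqrt hv, add_comm] at h
  simp only [gaussianMoment, ← h]
  refine lintegral_congr fun x => lintegral_congr fun z => ?_
  ring_nf

lemma lintegral_laplaceLaw_gaussianMoment {α : Type*} [MeasurableSpace α] {P : Measure α} [SFinite P]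
    {T : α → ℝ} (hT : Measurable T) (hT0 : ∀ᵐ τ ∂P, 0 ≤ T τ) (p y a : ℝ) :
    ∫⁻ x, ∫⁻ τ, gaussianMoment p (T τ) (y + a * x) ∂P ∂laplaceLaw =
      ∫⁻ τ, ∫⁻ t, gaussianMoment p (T τ + a ^ 2 * t) y ∂(expMeasure 1) ∂P := by
  have hH : Measurable fun x => ∫⁻ τ, gaussianMoment p (T τ) (y + a * x) ∂P := by
    have m1 : Measurable fun z : ℝ × α => y + a * z.1 := by fun_prop
    exact ((hT.comp measurable_snd).gaussianMoment m1 p).lintegral_prod_right'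
  have m2 : Measurable fun z : ℝ × α => T z.2 + a ^ 2 * z.1 := by fun_prop
  have m3 : Measurable fun z : ℝ × α => gaussianMoment p (T z.2 + a ^ 2 * z.1) y :=
    m2.gaussianMoment measurable_const p
  have h1 := lintegral_lintegral_swap (μ := expMeasure 1) (ν := P)
    (f := fun t τ => gaussianMoment p (T τ + a ^ 2 * t) y) m3.aemeasurable
  rw [lintegral_laplaceLaw hH, ← h1]
  refine lintegral_congr_ae (ae_pos_expMeasure_one.mono fun t ht => ?_)
  have m4 : Measurable fun z : ℝ × α => y + a * (√t * z.1) := by fun_prop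
  have m5 : Measurable fun z : ℝ × α => gaussianMoment p (T z.2) (y + a * (√t * z.1)) :=
    (hT.comp measurable_snd).gaussianMoment m4 p
  calc ∫⁻ x, ∫⁻ τ, gaussianMoment p (T τ) (y + a * (√t * x)) ∂P ∂(gaussianReal 0 1)
      = ∫⁻ τ, ∫⁻ x, gaussianMoment p (T τ) (y + a * (√t * x)) ∂(gaussianReal 0 1) ∂P :=
        lintegral_lintegral_swap m5.aemeasurable
    _ = _ := lintegral_congr_ae (hT0.mono fun τ hτ => lintegral_gaussianMoment p hτ ht.le y a)

lemma gaussianMoment_zero_right {p v : ℝ} (hv : 0 ≤ v) :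
    gaussianMoment p v 0 = ENNReal.ofReal (v ^ (p / 2)) * gaussianMoment p 1 0 := by
  simp only [gaussianMoment, zero_add, absRpow_mul]
  rw [lintegral_const_mul _ (measurable_absRpow p), lintegral_const_mul _ (measurable_absRpow p)]
  simp only [absRpow, Real.sqrt_one, abs_one, Real.one_rpow, ENNReal.ofReal_one, one_mul]
  rw [abs_of_nonneg (Real.sqrt_nonneg v), Real.sqrt_eq_rpow, ← Real.rpow_mul hv]
  ring_nf

lemma ae_expSum_nonneg {ι : Type*} [Fintype ι] (a : ι → ℝ) (s : Finset ι) :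
    ∀ᵐ τ ∂(Measure.pi fun _ : ι => expMeasure 1), 0 ≤ ∑ j ∈ s, a j ^ 2 * τ j := by
  have : ∀ᵐ τ ∂(Measure.pi fun _ : ι => expMeasure 1), ∀ j, 0 < τ j := by
    rw [ae_all_iff]
    exact fun j => (measurePreserving_eval (fun _ : ι => expMeasure 1) j).quasiMeasurePreserving.ae
      ae_pos_expMeasure_one
  exact this.mono fun τ hτ => Finset.sum_nonneg fun j _ => mul_nonneg (sq_nonneg _) (hτ j).le

section Sums

variable {ι Ω : Type*} [MeasurableSpace Ω] {μ : Measure Ω} [IsProbabilityMeasure μ]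
  {X : ι → Ω → ℝ}

lemma lintegral_sum_insert [DecidableEq ι] (hmeas : ∀ i, Measurable (X i)) (hindep : iIndepFun X μ)
    (a : ι → ℝ) {s : Finset ι} {i : ι} (hi : i ∉ s) (p y : ℝ) :
    ∫⁻ ω, absRpow p (y + ∑ j ∈ insert i s, a j * X j ω) ∂μ =
      ∫⁻ ω, ∫⁻ x, absRpow p (y + ∑ j ∈ s, a j * X j ω + a i * x) ∂(μ.map (X i)) ∂μ := by
  rw [← lintegral_indep_weighted_sum hmeas hindep a hi
    (F := fun z => absRpow p (y + z.1 + a i * z.2)) ((measurable_absRpow p).comp (by fun_prop))]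
  refine lintegral_congr fun ω => ?_
  rw [Finset.sum_insert hi]
  ring_nf

lemma lintegral_sum_le_mixture [Fintype ι] (h : ∀ i, IsNormalizedLogConcave (X i) μ)
    (hindep : iIndepFun X μ) (a : ι → ℝ) {p : ℝ} (hp : 3 ≤ p) (s : Finset ι) (y : ℝ) :
    ∫⁻ ω, absRpow p (y + ∑ i ∈ s, a i * X i ω) ∂μ ≤
      ∫⁻ τ, gaussianMoment p (∑ i ∈ s, a i ^ 2 * τ i) y
        ∂(Measure.pi fun _ : ι => expMeasure 1) := by
  classical
  set P : Measure (ι → ℝ) := Measure.pi fun _ : ι => expMeasure 1 with hP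
  induction s using Finset.induction_on generalizing y with
  | empty => simp [gaussianMoment]
  | insert i s hi ih =>
    have hXi := Measure.isProbabilityMeasure_map (μ := μ) (h i).measurable.aemeasurable
    have hmS : Measurable fun ω => ∑ j ∈ s, a j * X j ω :=
      Finset.measurable_fun_sum _ fun j _ => (h j).measurable.const_mul _
    have hmT : Measurable fun τ : ι → ℝ => ∑ j ∈ s, a j ^ 2 * τ j := by fun_prop
    have hτpos := ae_expSum_nonneg a s
    calc ∫⁻ ω, absRpow p (y + ∑ j ∈ insert i s, a j * X j ω) ∂μ
        = ∫⁻ ω, ∫⁻ x, absRpow p (y + ∑ j ∈ s, a j * X j ω + a i * x) ∂(μ.map (X i)) ∂μ :=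
          lintegral_sum_insert (fun j => (h j).measurable) hindep a hi p y
      _ ≤ ∫⁻ ω, ∫⁻ x, absRpow p (y + ∑ j ∈ s, a j * X j ω + a i * x) ∂laplaceLaw ∂μ :=
          lintegral_mono fun ω =>
            lintegral_absRpow_add_mul_le ((h i).lintegral_le_laplaceLaw hp) _ _
      _ = ∫⁻ x, ∫⁻ ω, absRpow p (y + a i * x + ∑ j ∈ s, a j * X j ω) ∂μ ∂laplaceLaw := by
          rw [lintegral_lintegral_swap]
          · refine lintegral_congr fun x => lintegral_congr fun ω => ?_
            ring_nf
          · refine ((measurable_absRpow p).comp ?_).aemeasurable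
            exact ((hmS.comp measurable_fst).const_add y).add (measurable_snd.const_mul _)
      _ ≤ ∫⁻ x, ∫⁻ τ, gaussianMoment p (∑ j ∈ s, a j ^ 2 * τ j) (y + a i * x) ∂P ∂laplaceLaw :=
          lintegral_mono fun x => ih _
      _ = ∫⁻ τ, ∫⁻ t, gaussianMoment p (∑ j ∈ s, a j ^ 2 * τ j + a i ^ 2 * t) y
            ∂(expMeasure 1) ∂P :=
          lintegral_laplaceLaw_gaussianMoment hmT hτpos p y (a i)
      _ = ∫⁻ τ, gaussianMoment p (∑ j ∈ insert i s, a j ^ 2 * τ j) y ∂P := by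
          have m1 : Measurable fun z : ℝ × ℝ => z.1 + a i ^ 2 * z.2 := by fun_prop
          have hev : ∀ j : ι, P.map (fun τ : ι → ℝ => τ j) = expMeasure 1 := fun j =>
            (measurePreserving_eval _ j).map_eq
          have := lintegral_indep_weighted_sum (μ := P) (X := fun j (τ : ι → ℝ) => τ j)
            (fun j => measurable_pi_apply j)
            (iIndepFun_pi (X := fun _ x => x) fun _ => aemeasurable_id) (fun j => a j ^ 2) hi
            (F := fun z => gaussianMoment p (z.1 + a i ^ 2 * z.2) y)
            (m1.gaussianMoment measurable_const p)
          rw [hev i] at this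
          rw [← this]
          refine lintegral_congr fun τ => ?_
          rw [Finset.sum_insert hi, add_comm]

/-- The upper bound for a sum whose squared coefficients are at most `β`. -/
lemma lintegral_sum_le_gaussianMoment [Fintype ι] (h : ∀ i, IsNormalizedLogConcave (X i) μ)
    (hindep : iIndepFun X μ) (a : ι → ℝ) {p : ℝ} (hp : 3 ≤ p) (s : Finset ι) {β : ℝ}
    (hβ0 : 0 ≤ β) (hβ : ∀ i ∈ s, a i ^ 2 ≤ β) :
    ∫⁻ ω, absRpow p (∑ i ∈ s, a i * X i ω) ∂μ ≤
      ENNReal.ofReal ((∑ i ∈ s, a i ^ 2 + (p / 2 - 1) * β) ^ (p / 2)) * gaussianMoment p 1 0 := by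
  have h1 := lintegral_sum_le_mixture h hindep a hp s 0
  simp only [zero_add] at h1
  refine h1.trans ?_
  set P : Measure (ι → ℝ) := Measure.pi fun _ : ι => expMeasure 1 with hP
  have hτpos := ae_expSum_nonneg a s
  rw [lintegral_congr_ae (hτpos.mono fun τ hτ => gaussianMoment_zero_right hτ),
    lintegral_mul_const _ (by fun_prop)]
  gcongr
  exact lintegral_expSum_rpow_le (P := P) (τ := fun j (τ : ι → ℝ) => τ j)
    (fun j => measurable_pi_apply j) (iIndepFun_pi (X := fun _ x => x) fun _ => aemeasurable_id)
    (fun j => (measurePreserving_eval _ j).map_eq) (fun i => sq_nonneg (a i)) hβ0 hβ (by linarith)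

end Sums
/-! ### Averages over signs -/

section Signs

variable {ι : Type*}

/-- The average of `f (x + ∑ i ∈ s, ± a i)` over all choices of the signs. A choice of signs is
encoded by the set `t ⊆ s` of the indices with sign `+`. -/
noncomputable def signAvg (a : ι → ℝ) (s : Finset ι) (f : ℝ → ℝ) (x : ℝ) : ℝ :=
  (∑ t ∈ s.powerset, f (x + 2 * ∑ i ∈ t, a i - ∑ i ∈ s, a i)) / 2 ^ s.card

lemma signAvg_empty (a : ι → ℝ) (f : ℝ → ℝ) (x : ℝ) : signAvg a ∅ f x = f x := by
  simp [signAvg]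

lemma signAvg_insert [DecidableEq ι] (a : ι → ℝ) {s : Finset ι} {i : ι} (hi : i ∉ s) (f : ℝ → ℝ)
    (x : ℝ) :
    signAvg a (insert i s) f x = (signAvg a s f (x + a i) + signAvg a s f (x - a i)) / 2 := by
  have h1 : ∀ t ∈ s.powerset, f (x + 2 * ∑ j ∈ insert i t, a j - (a i + ∑ j ∈ s, a j)) =
      f (x + a i + 2 * ∑ j ∈ t, a j - ∑ j ∈ s, a j) := fun t ht => by
    rw [Finset.sum_insert fun h => hi (Finset.mem_powerset.1 ht h)]
    ring_nf
  have h2 : ∀ t ∈ s.powerset, f (x + 2 * ∑ j ∈ t, a j - (a i + ∑ j ∈ s, a j)) =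
      f (x - a i + 2 * ∑ j ∈ t, a j - ∑ j ∈ s, a j) := fun t _ => by ring_nf
  rw [signAvg, signAvg, signAvg, Finset.sum_powerset_insert hi, Finset.card_insert_of_notMem hi,
    Finset.sum_insert hi, Finset.sum_congr rfl h1, Finset.sum_congr rfl h2, pow_succ]
  field_simp
  ring

lemma signAvg_nonneg (a : ι → ℝ) (s : Finset ι) {f : ℝ → ℝ} (hf : ∀ z, 0 ≤ f z) (x : ℝ) :
    0 ≤ signAvg a s f x :=
  div_nonneg (Finset.sum_nonneg fun _ _ => hf _) (by positivity)

lemma signAvg_cos_kernel (a : ι → ℝ) (s : Finset ι) (t x : ℝ) :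
    signAvg a s (fun z => Real.cos (t * z) - 1 + (t * z) ^ 2 / 2) x =
      Real.cos (t * x) * ∏ i ∈ s, Real.cos (t * a i) - 1 + t ^ 2 * (x ^ 2 + ∑ i ∈ s, a i ^ 2) / 2 := by
  classical
  induction s using Finset.induction_on generalizing x with
  | empty => simp [signAvg_empty, mul_pow]
  | insert i s hi ih =>
    rw [signAvg_insert a hi, ih, ih, Finset.prod_insert hi, Finset.sum_insert hi, mul_add, mul_sub,
      Real.cos_add, Real.cos_sub]
    ring

lemma signAvg_sq (a : ι → ℝ) (s : Finset ι) (x : ℝ) :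
    signAvg a s (fun z => z ^ 2) x = x ^ 2 + ∑ i ∈ s, a i ^ 2 := by
  classical
  induction s using Finset.induction_on generalizing x with
  | empty => simp [signAvg_empty]
  | insert i s hi ih =>
    rw [signAvg_insert a hi, ih, ih, Finset.sum_insert hi]
    ring

lemma le_mul_signedIncr {q : ℝ} (hq : 1 ≤ q) (z b : ℝ) :
    (q + 1) * b ^ 2 * |z| ^ q ≤ b / 2 * signedIncr q z b := by
  rcases le_total 0 b with hb | hb
  · have := mul_le_mul_of_nonneg_left (le_signedIncr hq z hb) (show 0 ≤ b / 2 by linarith)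
    linarith
  · have h := mul_le_mul_of_nonneg_left (le_signedIncr hq z (show 0 ≤ -b by linarith))
      (show 0 ≤ -b / 2 by linarith)
    have h2 : signedIncr q z (-b) = -signedIncr q z b := by
      simp only [signedIncr, sub_neg_eq_add, ← sub_eq_add_neg]
      ring
    rw [h2] at h
    linarith

lemma signAvg_increment_ge (a : ι → ℝ) (s : Finset ι) {q : ℝ} (hq : 1 ≤ q) (b x : ℝ) :
    (q + 1) * (b ^ 2 * signAvg a s (fun z => |z| ^ q) x) ≤
      b / 2 * (signAvg a s (fun z => |z| ^ q * z) (x + b) -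
        signAvg a s (fun z => |z| ^ q * z) (x - b)) := by
  simp only [signAvg]
  rw [← sub_div, ← Finset.sum_sub_distrib, ← mul_div_assoc, ← mul_div_assoc, ← mul_div_assoc,
    ← mul_assoc]
  refine div_le_div_of_nonneg_right ?_ (by positivity)
  rw [Finset.mul_sum, Finset.mul_sum]
  refine Finset.sum_le_sum fun t _ => ?_
  refine (le_mul_signedIncr hq _ b).trans (le_of_eq ?_)
  simp only [signedIncr]
  ring_nf

/-- A lower bound for the `p`-th moment of a sum of independent random signs by the moments of
order `p - 2` of the sums with one summand left out. It comes from `|z| ^ p = z * |z| ^ (p - 2) z`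
by integrating out one sign at a time and using the convexity of `|z| ^ (p - 2)`. -/
lemma signAvg_rpow_ge [DecidableEq ι] (a : ι → ℝ) (s : Finset ι) {p : ℝ} (hp : 3 ≤ p) (x : ℝ) :
    x * signAvg a s (fun z => |z| ^ (p - 2) * z) x +
        (p - 1) * ∑ i ∈ s, a i ^ 2 * signAvg a (s.erase i) (fun z => |z| ^ (p - 2)) x ≤
      signAvg a s (fun z => |z| ^ p) x := by
  induction s using Finset.induction_on generalizing x with
  | empty =>
    simp only [signAvg_empty, Finset.sum_empty, mul_zero, add_zero]
    rw [mul_left_comm, ← sq, ← sq_abs, ← Real.rpow_add_natCast' (abs_nonneg x)]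
    · norm_num
    · norm_num
      linarith
  | insert j s hj ih =>
    have hsum : ∑ i ∈ s, a i ^ 2 * signAvg a ((insert j s).erase i) (fun z => |z| ^ (p - 2)) x =
        (∑ i ∈ s, a i ^ 2 * signAvg a (s.erase i) (fun z => |z| ^ (p - 2)) (x + a j) +
        ∑ i ∈ s, a i ^ 2 * signAvg a (s.erase i) (fun z => |z| ^ (p - 2)) (x - a j)) / 2 := by
      rw [← Finset.sum_add_distrib, Finset.sum_div]
      refine Finset.sum_congr rfl fun i hi => ?_
      have hij : j ≠ i := fun h => hj (h ▸ hi)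
      rw [Finset.erase_insert_of_ne hij,
        signAvg_insert a fun h => hj (Finset.mem_of_mem_erase h)]
      ring
    rw [signAvg_insert a hj, signAvg_insert a hj, Finset.sum_insert hj, Finset.erase_insert hj,
      hsum]
    have h1 := ih (x + a j)
    have h2 := ih (x - a j)
    have h3 := signAvg_increment_ge a s (show 1 ≤ p - 2 by linarith) (a j) x
    rw [show p - 2 + 1 = p - 1 by ring] at h3
    linarith

end Signs

/-! ### Comparison with random signs -/

/-- Among the symmetric laws of variance `1`, the law of a random sign has the smallest `p`-th
absolute moments about each point. -/
lemma avg_absRpow_le_lintegral {ν : Measure ℝ} [IsProbabilityMeasure ν]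
    (hν : ν.map (fun x => -x) = ν) (h2 : ∫⁻ x, ENNReal.ofReal (x ^ 2) ∂ν = 1) {p : ℝ} (hp : 3 ≤ p)
    (y a : ℝ) :
    (absRpow p (y + a) + absRpow p (y - a)) / 2 ≤ ∫⁻ x, absRpow p (y + a * x) ∂ν := by
  set ρ : Measure ℝ := (2⁻¹ : ENNReal) • (Measure.dirac 1 + Measure.dirac (-1)) with hρ
  have hρint : ∀ f : ℝ → ENNReal, ∫⁻ x, f x ∂ρ = (f 1 + f (-1)) / 2 := fun f => by
    rw [hρ, lintegral_smul_measure, lintegral_add_measure, lintegral_dirac, lintegral_dirac,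
      smul_eq_mul, mul_comm, div_eq_mul_inv]
  have hρset : ∀ s : Set ℝ, MeasurableSet s → ρ s = (s.indicator 1 1 + s.indicator 1 (-1)) / 2 :=
    fun s hs => by rw [← lintegral_indicator_one hs, hρint]
  have : IsProbabilityMeasure ρ := ⟨by
    rw [hρset _ MeasurableSet.univ]
    simp only [Set.indicator_univ, Pi.one_apply]
    rw [one_add_one_eq_two, ENNReal.div_self (by norm_num) (by norm_num)]⟩
  have hρsymm : ρ.map (fun x => -x) = ρ := by
    rw [hρ, Measure.map_smul, Measure.map_add _ _ measurable_neg, Measure.map_dirac' measurable_neg,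
      Measure.map_dirac' measurable_neg, neg_neg, add_comm]
  have hρ2 : ∫⁻ x, ENNReal.ofReal (x ^ 2) ∂ρ = 1 := by
    rw [hρint]
    norm_num
    exact ENNReal.div_self (by norm_num) (by norm_num)
  have hρmeas : ∀ t : ℝ, MeasurableSet {x : ℝ | t ≤ |x|} := fun t =>
    measurableSet_le measurable_const (by fun_prop)
  have key := lintegral_absRpow_add_mul_le (μ := ρ) (ν := ν) (p := p) (fun y =>
    lintegral_absRpow_le_of_tail_crossing hρsymm hν (by rw [hρ2, h2]) (by simp [h2]) zero_le_one
      (fun t _ ht => by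
        have : ρ {x | t ≤ |x|} = 1 := by
          rw [hρset _ (hρmeas t), Set.indicator_of_mem (by simpa using ht.le),
            Set.indicator_of_mem (by simpa using ht.le)]
          simp only [Pi.one_apply]
          rw [one_add_one_eq_two, ENNReal.div_self (by norm_num) (by norm_num)]
        rw [this]
        exact prob_le_one)
      (fun t ht => by
        have : ρ {x | t ≤ |x|} = 0 := by
          rw [hρset _ (hρmeas t), Set.indicator_of_notMem (by simpa using ht),
            Set.indicator_of_notMem (by simpa using ht)]
          simp
        rw [this]
        exact zero_le) hp y) y a
  rw [hρint] at key
  simpa [sub_eq_add_neg] using key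

lemma signAvg_le_lintegral {ι Ω : Type*} [MeasurableSpace Ω] {μ : Measure Ω}
    [IsProbabilityMeasure μ] {X : ι → Ω → ℝ} (h : ∀ i, IsNormalizedLogConcave (X i) μ)
    (hindep : iIndepFun X μ) (a : ι → ℝ) {p : ℝ} (hp : 3 ≤ p) (s : Finset ι) (y : ℝ) :
    ENNReal.ofReal (signAvg a s (fun z => |z| ^ p) y) ≤
      ∫⁻ ω, absRpow p (y + ∑ i ∈ s, a i * X i ω) ∂μ := by
  classical
  induction s using Finset.induction_on generalizing y with
  | empty => simp [signAvg_empty, absRpow]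
  | insert i s hi ih =>
    have := Measure.isProbabilityMeasure_map (μ := μ) (h i).measurable.aemeasurable
    have hmS : Measurable fun ω => ∑ j ∈ s, a j * X j ω :=
      Finset.measurable_fun_sum _ fun j _ => (h j).measurable.const_mul _
    have hm : ∀ c, Measurable fun ω => absRpow p (c + ∑ j ∈ s, a j * X j ω) := fun c =>
      (measurable_absRpow p).comp (hmS.const_add c)
    have hnn : ∀ z, 0 ≤ signAvg a s (fun z => |z| ^ p) z :=
      signAvg_nonneg a s fun z => by positivity
    rw [signAvg_insert a hi, lintegral_sum_insert (fun j => (h j).measurable) hindep a hi,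
      ENNReal.ofReal_div_of_pos (by norm_num), ENNReal.ofReal_add (hnn _) (hnn _)]
    calc _ ≤ (∫⁻ ω, absRpow p (y + a i + ∑ j ∈ s, a j * X j ω) ∂μ +
          ∫⁻ ω, absRpow p (y - a i + ∑ j ∈ s, a j * X j ω) ∂μ) / ENNReal.ofReal 2 :=
          ENNReal.div_le_div_right (add_le_add (ih _) (ih _)) _
      _ = ∫⁻ ω, (absRpow p (y + ∑ j ∈ s, a j * X j ω + a i) +
          absRpow p (y + ∑ j ∈ s, a j * X j ω - a i)) / 2 ∂μ := by
          rw [← lintegral_add_left (hm _)]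
          simp_rw [div_eq_mul_inv]
          rw [lintegral_mul_const _ (by
            have m1 : Measurable fun ω => absRpow p (y + ∑ j ∈ s, a j * X j ω + a i) :=
              (measurable_absRpow p).comp ((hmS.const_add y).add_const _)
            have m2 : Measurable fun ω => absRpow p (y + ∑ j ∈ s, a j * X j ω - a i) :=
              (measurable_absRpow p).comp ((hmS.const_add y).sub_const _)
            exact m1.add m2)]
          congr 1
          · refine lintegral_congr fun ω => ?_
            ring_nf
          · simp
      _ ≤ _ := lintegral_mono fun ω =>
          avg_absRpow_le_lintegral (h i).map_neg (h i).lintegral_sq hp _ _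

/-- Adding summands increases the `p`-th moment. -/
lemma lintegral_sum_mono {ι Ω : Type*} [MeasurableSpace Ω] {μ : Measure Ω}
    [IsProbabilityMeasure μ] {X : ι → Ω → ℝ} (h : ∀ i, IsNormalizedLogConcave (X i) μ)
    (hindep : iIndepFun X μ) (a : ι → ℝ) {p : ℝ} (hp : 1 ≤ p) {s t : Finset ι} (hst : s ⊆ t) :
    ∫⁻ ω, absRpow p (∑ i ∈ s, a i * X i ω) ∂μ ≤ ∫⁻ ω, absRpow p (∑ i ∈ t, a i * X i ω) ∂μ := by
  classical
  suffices H : ∀ r : Finset ι, Disjoint s r →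
      ∫⁻ ω, absRpow p (∑ i ∈ s, a i * X i ω) ∂μ ≤
        ∫⁻ ω, absRpow p (∑ i ∈ s ∪ r, a i * X i ω) ∂μ by
    have := H (t \ s) Finset.disjoint_sdiff
    rwa [Finset.union_sdiff_of_subset hst] at this
  intro r
  induction r using Finset.induction_on with
  | empty => simp
  | insert i r hi ih =>
    intro hd
    rw [Finset.disjoint_insert_right] at hd
    refine (ih hd.2).trans ?_
    have hi' : i ∉ s ∪ r := by simp [hd.1, hi]
    have := lintegral_sum_insert (fun j => (h j).measurable) hindep a hi' p 0
    simp only [zero_add] at this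
    rw [Finset.union_insert, this]
    have := Measure.isProbabilityMeasure_map (μ := μ) (h i).measurable.aemeasurable
    exact lintegral_mono fun ω => absRpow_le_lintegral (h i).map_neg hp _ _
/-! ### The Gaussian lower bound for cosine products -/

lemma exp_neg_sq_div_le_cos {x y : ℝ} (hx : x < Real.pi / 2) (hy : |y| ≤ x) :
    Real.exp (-(y ^ 2 / (2 * Real.cos x))) ≤ Real.cos y := by
  wlog hy0 : 0 ≤ y generalizing y
  · have := this (y := -y) (by rwa [abs_neg]) (by linarith)
    simpa using this
  rw [abs_of_nonneg hy0] at hy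
  have hx0 : 0 ≤ x := hy0.trans hy
  have hc : 0 < Real.cos x := Real.cos_pos_of_mem_Ioo ⟨by linarith [Real.pi_pos], hx⟩
  have hmono : MonotoneOn (fun u => Real.cos u * Real.exp (u ^ 2 / (2 * Real.cos x)))
      (Set.Icc 0 x) := by
    have hd : ∀ u : ℝ, HasDerivAt (fun u => Real.cos u * Real.exp (u ^ 2 / (2 * Real.cos x)))
        ((u / Real.cos x * Real.cos u - Real.sin u) * Real.exp (u ^ 2 / (2 * Real.cos x))) u := by
      intro u
      have h1 : HasDerivAt (fun u : ℝ => u ^ 2 / (2 * Real.cos x)) (u / Real.cos x) u := by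
        refine ((hasDerivAt_pow 2 u).div_const _).congr_deriv ?_
        field_simp
        simp
      exact ((Real.hasDerivAt_cos u).mul h1.exp).congr_deriv (by ring)
    refine monotoneOn_of_deriv_nonneg (convex_Icc 0 x) (by fun_prop)
      (fun u _ => (hd u).differentiableAt.differentiableWithinAt) fun u hu => ?_
    rw [interior_Icc] at hu
    rw [(hd u).deriv]
    refine mul_nonneg ?_ (Real.exp_pos _).le
    have h1 : Real.cos x ≤ Real.cos u :=
      Real.cos_le_cos_of_nonneg_of_le_pi hu.1.le (by linarith [Real.pi_pos]) hu.2.le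
    have h2 : Real.sin u ≤ u := Real.sin_le hu.1.le
    have h3 : u ≤ u / Real.cos x * Real.cos u := by
      rw [div_mul_eq_mul_div, le_div_iff₀ hc]
      exact mul_le_mul_of_nonneg_left h1 hu.1.le
    linarith
  have h := hmono (Set.left_mem_Icc.2 hx0) ⟨hy0, hy⟩ hy0
  simp only [Real.cos_zero, ne_eq, OfNat.ofNat_ne_zero, not_false_eq_true, zero_pow, zero_div,
    Real.exp_zero, mul_one] at h
  rw [Real.exp_neg, inv_le_iff_one_le_mul₀ (Real.exp_pos _)]
  exact h

/-- A cosine product, corrected by the quadratic term of its largest argument `x`, dominates the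
Gaussian characteristic function with the variance of the other arguments. For `c = cos x > 0` each
factor is at least `exp (-y ^ 2 / (2 c))`, and `w ≤ (1 - c) + c w ^ (1 / c)` by the weighted
inequality between arithmetic and geometric means. -/
lemma exp_neg_sum_sq_le_cos_mul_prod {ι : Type*} (s : Finset ι) (y : ι → ℝ) {x : ℝ} (hx : 0 ≤ x)
    (hy : ∀ i ∈ s, |y i| ≤ x) :
    Real.exp (-((∑ i ∈ s, y i ^ 2) / 2)) ≤
      Real.cos x * ∏ i ∈ s, Real.cos (y i) + x ^ 2 / 2 := by
  have hcx := Real.one_sub_sq_div_two_le_cos (x := x)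
  rcases le_or_gt (Real.pi / 2) x with hpi | hpi
  · have h1 : |∏ i ∈ s, Real.cos (y i)| ≤ 1 := by
      rw [Finset.abs_prod]
      exact Finset.prod_le_one (fun _ _ => abs_nonneg _) fun i _ => Real.abs_cos_le_one _
    have h2 : Real.exp (-((∑ i ∈ s, y i ^ 2) / 2)) ≤ 1 :=
      Real.exp_le_one_iff.2 (by
        have : 0 ≤ ∑ i ∈ s, y i ^ 2 := Finset.sum_nonneg fun i _ => sq_nonneg _
        linarith)
    have h3 : -|Real.cos x| ≤ Real.cos x * ∏ i ∈ s, Real.cos (y i) := by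
      have := neg_abs_le (Real.cos x * ∏ i ∈ s, Real.cos (y i))
      rw [abs_mul] at this
      nlinarith [abs_nonneg (Real.cos x)]
    rcases le_or_gt (Real.cos x) 0 with hc | hc
    · rw [abs_of_nonpos hc] at h3
      linarith
    · -- `cos x > 0` and `x ≥ π / 2` force `x ≥ 2`
      rw [abs_of_pos hc] at h3
      have h4 : 2 ≤ x := by
        by_contra hx2
        have h5 : Real.cos x ≤ 0 :=
          Real.cos_nonpos_of_pi_div_two_le_of_le hpi (by linarith [Real.pi_gt_three])
        linarith
      nlinarith [Real.cos_le_one x]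
  · set c := Real.cos x with hc
    have hc0 : 0 < c := Real.cos_pos_of_mem_Ioo ⟨by linarith [Real.pi_pos], hpi⟩
    have hc1 : c ≤ 1 := Real.cos_le_one x
    set v := ∑ i ∈ s, y i ^ 2 with hv
    have hprod : Real.exp (-(v / (2 * c))) ≤ ∏ i ∈ s, Real.cos (y i) := by
      rw [hv, Finset.sum_div, ← Finset.sum_neg_distrib, Real.exp_sum]
      exact Finset.prod_le_prod (fun _ _ => (Real.exp_pos _).le) fun i hi =>
        exp_neg_sq_div_le_cos hpi (hy i hi)
    have hamgm := Real.geom_mean_le_arith_mean2_weighted (show 0 ≤ 1 - c by linarith) hc0.le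
      zero_le_one (Real.exp_pos (-(v / (2 * c)))).le (by ring)
    rw [Real.one_rpow, one_mul, ← Real.exp_mul, mul_one] at hamgm
    rw [show -(v / (2 * c)) * c = -(v / 2) by field_simp] at hamgm
    nlinarith [mul_le_mul_of_nonneg_left hprod hc0.le]

lemma exp_neg_add_self_mono {u v : ℝ} (hu : 0 ≤ u) (huv : u ≤ v) :
    Real.exp (-u) + u ≤ Real.exp (-v) + v := by
  have h1 := Real.add_one_le_exp (-(v - u))
  have h2 : Real.exp (-v) = Real.exp (-u) * Real.exp (-(v - u)) := by
    rw [← Real.exp_add]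
    ring_nf
  have h3 : Real.exp (-u) ≤ 1 := Real.exp_le_one_iff.2 (by linarith)
  rw [h2]
  nlinarith [Real.exp_pos (-u)]

/-- The comparison of the Fourier kernels of a Gaussian variable and of a sum of random signs. -/
lemma gaussian_kernel_le_cos_kernel {ι : Type*} [DecidableEq ι] (a : ι → ℝ) (s : Finset ι) {D : ℝ}
    (hD : 0 ≤ D) (hDs : D ≤ ∑ i ∈ s, a i ^ 2) (hDe : ∀ i ∈ s, D ≤ ∑ j ∈ s.erase i, a j ^ 2)
    (t : ℝ) :
    Real.exp (-(t ^ 2 * D / 2)) - 1 + t ^ 2 * D / 2 ≤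
      ∏ i ∈ s, Real.cos (t * a i) - 1 + t ^ 2 * (∑ i ∈ s, a i ^ 2) / 2 := by
  rcases s.eq_empty_or_nonempty with rfl | hs
  · have : D = 0 := le_antisymm (by simpa using hDs) hD
    simp [this]
  obtain ⟨i, hi, himax⟩ := s.exists_max_image (fun j => |a j|) hs
  have h1 := exp_neg_sum_sq_le_cos_mul_prod (s.erase i) (fun j => t * a j) (abs_nonneg (t * a i))
    (fun j hj => by
      rw [abs_mul, abs_mul]
      exact mul_le_mul_of_nonneg_left (himax j (Finset.mem_of_mem_erase hj)) (abs_nonneg t))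
  rw [Real.cos_abs, Finset.mul_prod_erase s (fun j => Real.cos (t * a j)) hi, sq_abs] at h1
  simp_rw [mul_pow] at h1
  rw [← Finset.mul_sum] at h1
  have h2 := exp_neg_add_self_mono (u := t ^ 2 * D / 2)
    (v := t ^ 2 * (∑ j ∈ s.erase i, a j ^ 2) / 2) (by positivity) (by
      have := hDe i hi
      gcongr)
  rw [← Finset.add_sum_erase s (fun j => a j ^ 2) hi]
  linarith

/-! ### The Fourier representation of `|x| ^ p` for `2 < p < 4` -/

/-- The integral of the remainder `cos (t x) - 1 + (t x) ^ 2 / 2` against `t ^ (-p - 1)`, which is a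
multiple of `|x| ^ p`. -/
noncomputable def cosTransform (p x : ℝ) : ENNReal :=
  ∫⁻ t in Set.Ioi 0, ENNReal.ofReal
    ((Real.cos (t * x) - 1 + (t * x) ^ 2 / 2) * t ^ (-p - 1))

lemma cos_kernel_nonneg (u : ℝ) : 0 ≤ Real.cos u - 1 + u ^ 2 / 2 := by
  linarith [Real.one_sub_sq_div_two_le_cos (x := u)]

lemma lintegral_Ioi_comp_mul {f : ℝ → ENNReal} (hf : Measurable f) {c : ℝ} (hc : 0 < c) :
    ∫⁻ t in Set.Ioi 0, f (c * t) = ENNReal.ofReal c⁻¹ * ∫⁻ t in Set.Ioi 0, f t := by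
  rw [← lintegral_indicator measurableSet_Ioi, ← lintegral_indicator measurableSet_Ioi]
  have h : ∀ t, (Set.Ioi (0 : ℝ)).indicator (fun t => f (c * t)) t =
      (Set.Ioi (0 : ℝ)).indicator f (c * t) := fun t => by
    by_cases ht : 0 < t
    · rw [Set.indicator_of_mem (Set.mem_Ioi.2 ht),
        Set.indicator_of_mem (Set.mem_Ioi.2 (mul_pos hc ht))]
    · rw [Set.indicator_of_notMem (by simpa using ht), Set.indicator_of_notMem]
      simpa using mul_nonpos_of_nonneg_of_nonpos hc.le (not_lt.1 ht)
  simp_rw [h]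
  rw [← lintegral_map (hf.indicator measurableSet_Ioi) (measurable_const_mul c),
    Real.map_volume_mul_left hc.ne', lintegral_smul_measure, abs_of_pos (inv_pos.2 hc), smul_eq_mul]

lemma cosTransform_eq {p : ℝ} (hp : 0 < p) (x : ℝ) :
    cosTransform p x = absRpow p x * cosTransform p 1 := by
  rcases eq_or_ne x 0 with rfl | hx
  · simp [cosTransform, absRpow, hp.ne']
  have hc : 0 < |x| := abs_pos.2 hx
  set F : ℝ → ENNReal := fun t => ENNReal.ofReal
    ((Real.cos (t * 1) - 1 + (t * 1) ^ 2 / 2) * t ^ (-p - 1)) with hF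
  have hFm : Measurable F := by fun_prop
  have h1 : cosTransform p x =
      ∫⁻ t in Set.Ioi 0, ENNReal.ofReal (|x| ^ (p + 1)) * F (|x| * t) := by
    refine setLIntegral_congr_fun measurableSet_Ioi fun t ht => ?_
    have ht : 0 < t := ht
    rw [hF, ← ENNReal.ofReal_mul (by positivity)]
    congr 1
    have h2 : Real.cos (|x| * t * 1) = Real.cos (t * x) := by
      rw [← Real.cos_abs (t * x), abs_mul, abs_of_pos ht]
      ring_nf
    have h3 : (|x| * t * 1) ^ 2 = (t * x) ^ 2 := by
      rw [mul_one, mul_pow, mul_pow, sq_abs]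
      ring
    have h4 : |x| ^ (p + 1) * (|x| * t) ^ (-p - 1) = t ^ (-p - 1) := by
      rw [Real.mul_rpow hc.le ht.le, ← mul_assoc, ← Real.rpow_add hc]
      simp
    rw [h2, h3, ← h4]
    ring
  have hFm' : Measurable fun t => F (|x| * t) := hFm.comp (measurable_const_mul _)
  rw [h1, lintegral_const_mul _ hFm', lintegral_Ioi_comp_mul hFm hc,
    ← mul_assoc, ← ENNReal.ofReal_mul (by positivity), Real.rpow_add_one hc.ne',
    mul_assoc, mul_inv_cancel₀ hc.ne', mul_one]
  rfl

lemma cosTransform_one_ne_zero (p : ℝ) : cosTransform p 1 ≠ 0 := by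
  rw [cosTransform, ← pos_iff_ne_zero, setLIntegral_pos_iff (by fun_prop)]
  refine lt_of_lt_of_le (?_ : 0 < volume (Set.Ioo (0 : ℝ) 1)) (measure_mono fun t ht => ⟨?_, ht.1⟩)
  · simp
  · rw [Function.mem_support, ← pos_iff_ne_zero, ENNReal.ofReal_pos, mul_one]
    have := Real.one_sub_sq_div_two_lt_cos ht.1.ne'
    exact mul_pos (by linarith) (Real.rpow_pos_of_pos ht.1 _)

lemma cosTransform_one_ne_top {p : ℝ} (hp2 : 2 < p) (hp4 : p < 4) : cosTransform p 1 ≠ ⊤ := by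
  have hset : Set.Ioi (0 : ℝ) = Set.Ioc 0 1 ∪ Set.Ioi 1 :=
    (Set.Ioc_union_Ioi_eq_Ioi zero_le_one).symm
  rw [cosTransform, hset]
  refine ((lintegral_union_le _ _ _).trans_lt (ENNReal.add_lt_top.2 ⟨?_, ?_⟩)).ne
  · have hint : IntegrableOn (fun t : ℝ => t ^ (3 - p)) (Set.Ioc 0 1) :=
      (intervalIntegrable_iff_integrableOn_Ioc_of_le zero_le_one).1
        (intervalIntegral.intervalIntegrable_rpow' (by linarith))
    refine lt_of_le_of_lt (setLIntegral_mono' measurableSet_Ioc fun t ht => ?_)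
      hint.lintegral_lt_top
    refine ENNReal.ofReal_le_ofReal ?_
    have ht0 := ht.1
    have h1 := (abs_le.1 (Real.cos_bound (x := t) (by rw [abs_of_pos ht0]; exact ht.2))).2
    rw [abs_of_pos ht0] at h1
    have h2 : t ^ (3 - p) = t ^ 4 * t ^ (-p - 1) := by
      rw [← Real.rpow_natCast, ← Real.rpow_add ht0]
      norm_num
      ring_nf
    rw [h2, mul_one]
    refine mul_le_mul_of_nonneg_right ?_ (Real.rpow_nonneg ht0.le _)
    nlinarith [pow_pos ht0 4]
  · have hint : IntegrableOn (fun t : ℝ => t ^ (1 - p)) (Set.Ioi 1) :=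
      integrableOn_Ioi_rpow_of_lt (by linarith) one_pos
    refine lt_of_le_of_lt (setLIntegral_mono' measurableSet_Ioi fun t ht => ?_)
      hint.lintegral_lt_top
    refine ENNReal.ofReal_le_ofReal ?_
    have ht0 : 0 < t := one_pos.trans ht
    have h2 : t ^ (1 - p) = t ^ 2 * t ^ (-p - 1) := by
      rw [← Real.rpow_natCast, ← Real.rpow_add ht0]
      norm_num
      ring_nf
    rw [h2, mul_one]
    refine mul_le_mul_of_nonneg_right ?_ (Real.rpow_nonneg ht0.le _)
    nlinarith [Real.cos_le_one t, sq_nonneg t]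

lemma signAvg_mul_cosTransform {ι : Type*} (a : ι → ℝ) (s : Finset ι) {p : ℝ} (hp : 0 < p) (x : ℝ) :
    ENNReal.ofReal (signAvg a s (fun z => |z| ^ p) x) * cosTransform p 1 =
      ∫⁻ t in Set.Ioi 0, ENNReal.ofReal
        (signAvg a s (fun z => Real.cos (t * z) - 1 + (t * z) ^ 2 / 2) x * t ^ (-p - 1)) := by
  classical
  induction s using Finset.induction_on generalizing x with
  | empty =>
    simp only [signAvg_empty]
    exact (cosTransform_eq hp x).symm
  | insert i s hi ih =>
    have hnn : ∀ z, 0 ≤ signAvg a s (fun z => |z| ^ p) z :=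
      signAvg_nonneg a s fun z => by positivity
    have hm : ∀ z, Measurable fun t : ℝ => ENNReal.ofReal
        (signAvg a s (fun z => Real.cos (t * z) - 1 + (t * z) ^ 2 / 2) z * t ^ (-p - 1)) := by
      intro z
      simp_rw [signAvg_cos_kernel]
      fun_prop
    have hm2 : Measurable fun t : ℝ =>
        ENNReal.ofReal (signAvg a s (fun z => Real.cos (t * z) - 1 + (t * z) ^ 2 / 2) (x + a i) *
          t ^ (-p - 1)) +
        ENNReal.ofReal (signAvg a s (fun z => Real.cos (t * z) - 1 + (t * z) ^ 2 / 2) (x - a i) *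
          t ^ (-p - 1)) := (hm _).add (hm _)
    rw [signAvg_insert a hi, ENNReal.ofReal_div_of_pos (by norm_num), div_eq_mul_inv,
      ENNReal.ofReal_add (hnn _) (hnn _), mul_right_comm, add_mul, ih, ih,
      ← lintegral_add_left (hm _), ← lintegral_mul_const _ hm2]
    refine setLIntegral_congr_fun measurableSet_Ioi fun t ht => ?_
    have ht : 0 < t := ht
    have hkn : ∀ z, 0 ≤ signAvg a s (fun z => Real.cos (t * z) - 1 + (t * z) ^ 2 / 2) z *
        t ^ (-p - 1) := fun z =>
      mul_nonneg (signAvg_nonneg a s (fun z => cos_kernel_nonneg _) z) (Real.rpow_nonneg ht.le _)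
    rw [← ENNReal.ofReal_add (hkn _) (hkn _), ← div_eq_mul_inv,
      ← ENNReal.ofReal_div_of_pos (by norm_num), signAvg_insert a hi]
    congr 1
    ring

lemma integral_cos_gaussianReal (u : ℝ) :
    ∫ x, Real.cos (u * x) ∂(gaussianReal 0 1) = Real.exp (-(u ^ 2 / 2)) := by
  have h := charFun_gaussianReal (μ := 0) (v := 1) u
  rw [charFun_apply_real] at h
  have hi : Integrable (fun x : ℝ => Complex.exp (u * x * Complex.I)) (gaussianReal 0 1) := by
    refine Integrable.of_bound (by fun_prop) 1 (Filter.Eventually.of_forall fun x => ?_)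
    rw [← Complex.ofReal_mul, Complex.norm_exp_ofReal_mul_I]
  have h2 := congrArg Complex.re h
  have h3 : (∫ x : ℝ, Complex.exp (u * x * Complex.I) ∂(gaussianReal 0 1)).re =
      ∫ x : ℝ, (Complex.exp (u * x * Complex.I)).re ∂(gaussianReal 0 1) := (integral_re hi).symm
  rw [h3] at h2
  have h4 : ∀ x : ℝ, (Complex.exp (u * x * Complex.I)).re = Real.cos (u * x) := fun x => by
    rw [← Complex.ofReal_mul, Complex.exp_ofReal_mul_I_re]
  simp_rw [h4] at h2
  rw [h2]
  have h5 : (u * (0 : ℝ) * Complex.I - (1 : NNReal) * u ^ 2 / 2 : ℂ) = ((-(u ^ 2 / 2) : ℝ) : ℂ) := by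
    push_cast
    ring
  rw [h5, Complex.exp_ofReal_re]

lemma gaussianMoment_mul_cosTransform {p : ℝ} (hp : 0 < p) {D : ℝ} (hD : 0 ≤ D) :
    gaussianMoment p D 0 * cosTransform p 1 =
      ∫⁻ t in Set.Ioi 0, ENNReal.ofReal
        ((Real.exp (-(t ^ 2 * D / 2)) - 1 + t ^ 2 * D / 2) * t ^ (-p - 1)) := by
  have hm : Measurable fun z : ℝ × ℝ => ENNReal.ofReal
      ((Real.cos (z.2 * (√D * z.1)) - 1 + (z.2 * (√D * z.1)) ^ 2 / 2) * z.2 ^ (-p - 1)) := by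
    fun_prop
  simp only [gaussianMoment, zero_add]
  have hm0 : Measurable fun x => absRpow p (√D * x) :=
    (measurable_absRpow p).comp (measurable_const_mul _)
  rw [← lintegral_mul_const _ hm0]
  simp_rw [← cosTransform_eq hp, cosTransform]
  rw [lintegral_lintegral_swap hm.aemeasurable]
  refine setLIntegral_congr_fun measurableSet_Ioi fun t ht => ?_
  have ht : 0 < t := ht
  have htp : 0 ≤ t ^ (-p - 1) := Real.rpow_nonneg ht.le _
  have hi1 : Integrable (fun x => Real.cos (t * (√D * x))) (gaussianReal 0 1) :=
    Integrable.of_bound (by fun_prop) 1 (Filter.Eventually.of_forall fun x =>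
      Real.abs_cos_le_one _)
  have hi2 : Integrable (fun x : ℝ => x ^ 2) (gaussianReal 0 1) :=
    (memLp_id_gaussianReal 2).integrable_sq
  have hi3 : Integrable (fun x : ℝ => t ^ 2 * D / 2 * x ^ 2) (gaussianReal 0 1) :=
    hi2.const_mul _
  have hfun : ∀ x : ℝ, Real.cos (t * (√D * x)) - 1 + (t * (√D * x)) ^ 2 / 2 =
      Real.cos (t * (√D * x)) - 1 + t ^ 2 * D / 2 * x ^ 2 := fun x => by
    rw [mul_pow, mul_pow, Real.sq_sqrt hD]
    ring
  have hsq : ∫ x, x ^ 2 ∂(gaussianReal 0 1) = 1 := by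
    have h := variance_fun_id_gaussianReal (μ := 0) (v := 1)
    rw [variance_of_integral_eq_zero (by fun_prop) (by simp)] at h
    simpa using h
  have hI : ∫ x, (Real.cos (t * (√D * x)) - 1 + (t * (√D * x)) ^ 2 / 2) ∂(gaussianReal 0 1) =
      Real.exp (-(t ^ 2 * D / 2)) - 1 + t ^ 2 * D / 2 := by
    simp_rw [hfun]
    have hcos := integral_cos_gaussianReal (t * √D)
    simp_rw [mul_assoc] at hcos
    have hi4 : Integrable (fun x => Real.cos (t * (√D * x)) - 1) (gaussianReal 0 1) :=
      hi1.sub (integrable_const _)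
    rw [integral_add hi4 hi3, integral_sub hi1 (integrable_const _),
      integral_const_mul, hsq, hcos, mul_pow, Real.sq_sqrt hD]
    simp
  have hii : Integrable (fun x => Real.cos (t * (√D * x)) - 1 + (t * (√D * x)) ^ 2 / 2)
      (gaussianReal 0 1) := by
    simp_rw [hfun]
    exact (hi1.sub (integrable_const _)).add hi3
  rw [← ofReal_integral_eq_lintegral_ofReal (hii.mul_const _)
    (Filter.Eventually.of_forall fun x => mul_nonneg (cos_kernel_nonneg _) htp),
    integral_mul_const, hI]

lemma gaussianMoment_le_signAvg_of_lt_four {ι : Type*} [DecidableEq ι] (a : ι → ℝ) (s : Finset ι)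
    {p : ℝ} (hp2 : 2 < p) (hp4 : p < 4) {D : ℝ} (hD : 0 ≤ D) (hDs : D ≤ ∑ i ∈ s, a i ^ 2)
    (hDe : ∀ i ∈ s, D ≤ ∑ j ∈ s.erase i, a j ^ 2) :
    gaussianMoment p D 0 ≤ ENNReal.ofReal (signAvg a s (fun z => |z| ^ p) 0) := by
  rw [← ENNReal.mul_le_mul_iff_left (cosTransform_one_ne_zero p) (cosTransform_one_ne_top hp2 hp4),
    gaussianMoment_mul_cosTransform (by linarith) hD, signAvg_mul_cosTransform a s (by linarith)]
  refine setLIntegral_mono' measurableSet_Ioi fun t ht => ENNReal.ofReal_le_ofReal ?_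
  rw [signAvg_cos_kernel]
  refine mul_le_mul_of_nonneg_right ?_ (Real.rpow_nonneg (le_of_lt ht) _)
  simpa using gaussian_kernel_le_cos_kernel a s hD hDs hDe t
/-! ### The lower bound for sums of random signs -/

lemma gaussianMoment_one_zero (p : ℝ) :
    gaussianMoment p 1 0 = ∫⁻ x, absRpow p x ∂(gaussianReal 0 1) := by
  simp [gaussianMoment]

lemma gaussianMoment_one_ne_top {p : ℝ} (hp : 0 < p) : gaussianMoment p 1 0 ≠ ⊤ := by
  rw [gaussianMoment_one_zero]
  exact (memLp_ofReal_iff measurable_id hp).1 (memLp_id_gaussianReal' _ ENNReal.ofReal_ne_top)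

lemma gaussianMoment_one_eq {p : ℝ} (hp : 0 < p) :
    gaussianMoment p 1 0 = ENNReal.ofReal
      (2 * (√(2 * Real.pi))⁻¹ * (2⁻¹ ^ (-(p + 1) / 2) * (1 / 2) * Real.Gamma ((p + 1) / 2))) := by
  have hi : Integrable (fun x : ℝ => |x| ^ p) (gaussianReal 0 1) := by
    refine ⟨(continuous_abs.rpow_const fun _ => Or.inr hp.le).aestronglyMeasurable, ?_⟩
    have := gaussianMoment_one_ne_top hp
    rw [gaussianMoment_one_zero] at this
    rw [hasFiniteIntegral_iff_ofReal (Filter.Eventually.of_forall fun x => by positivity)]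
    exact this.lt_top
  rw [gaussianMoment_one_zero]
  simp only [absRpow]
  rw [← ofReal_integral_eq_lintegral_ofReal hi (Filter.Eventually.of_forall fun x => by positivity),
    integral_gaussianReal_eq_integral_smul one_ne_zero,
    ← integral_rpow_mul_exp_neg_mul_rpow (p := 2) (q := p) (by norm_num) (by linarith)
      (by norm_num)]
  have h1 : ∀ x : ℝ, gaussianPDFReal 0 1 x • |x| ^ p =
      (fun y => (√(2 * Real.pi))⁻¹ * (y ^ p * Real.exp (-2⁻¹ * y ^ (2 : ℝ)))) |x| := by
    intro x
    simp only [gaussianPDFReal, NNReal.coe_one, mul_one, sub_zero, smul_eq_mul, Real.rpow_two,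
      sq_abs]
    ring_nf
  simp_rw [h1]
  rw [integral_comp_abs (f := fun y =>
    (√(2 * Real.pi))⁻¹ * (y ^ p * Real.exp (-2⁻¹ * y ^ (2 : ℝ)))), integral_const_mul, ← mul_assoc]

/-- The recursion `E |g| ^ p = (p - 1) E |g| ^ (p - 2)` for a standard Gaussian variable `g`. -/
lemma gaussianMoment_one_rec {p : ℝ} (hp : 2 < p) :
    gaussianMoment p 1 0 = ENNReal.ofReal (p - 1) * gaussianMoment (p - 2) 1 0 := by
  rw [gaussianMoment_one_eq (by linarith), gaussianMoment_one_eq (by linarith),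
    ← ENNReal.ofReal_mul (by linarith)]
  congr 1
  have h1 : (p + 1) / 2 = (p - 2 + 1) / 2 + 1 := by ring
  have h2 : -(p + 1) / 2 = -(p - 2 + 1) / 2 - 1 := by ring
  rw [h1, h2, Real.Gamma_add_one (by linarith), Real.rpow_sub_one (by norm_num)]
  field_simp
  ring

lemma gaussianMoment_rec {p : ℝ} (hp : 2 < p) {D : ℝ} (hD : 0 ≤ D) :
    gaussianMoment p D 0 = ENNReal.ofReal ((p - 1) * D) * gaussianMoment (p - 2) D 0 := by
  have h : D ^ (p / 2) = D * D ^ ((p - 2) / 2) := by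
    rw [mul_comm, ← Real.rpow_add_one' hD (by linarith)]
    congr 1
    ring
  rw [gaussianMoment_zero_right hD, gaussianMoment_zero_right hD, gaussianMoment_one_rec hp, h,
    ENNReal.ofReal_mul hD, ENNReal.ofReal_mul (by linarith)]
  ring

lemma gaussianMoment_two {D : ℝ} (hD : 0 ≤ D) : gaussianMoment 2 D 0 = ENNReal.ofReal D := by
  rw [gaussianMoment_zero_right hD, gaussianMoment_one_zero]
  simp only [absRpow, Real.rpow_two, sq_abs, lintegral_sq_gaussianReal]
  norm_num

/-- If the squared coefficients have sum at least `D` after the removal of any `⌈p / 2⌉ - 1` of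
them, then the `p`-th moment of the sum of random signs is at least that of a Gaussian variable of
variance `D`. -/
lemma gaussianMoment_le_signAvg {ι : Type*} [DecidableEq ι] (a : ι → ℝ) (m : ℕ) :
    ∀ p : ℝ, 2 ≤ p → p < 2 * m + 4 → ∀ (s : Finset ι) (D : ℝ), 0 ≤ D →
      (∀ T ⊆ s, T.card ≤ ⌈p / 2⌉₊ - 1 → D ≤ ∑ i ∈ s \ T, a i ^ 2) →
      gaussianMoment p D 0 ≤ ENNReal.ofReal (signAvg a s (fun z => |z| ^ p) 0) := by
  induction m with
  | zero =>
    intro p hp2 hp4 s D hD hT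
    have hDs : D ≤ ∑ i ∈ s, a i ^ 2 := by simpa using hT ∅ (Finset.empty_subset _) (by simp)
    rcases hp2.eq_or_lt with rfl | hp2
    · rw [gaussianMoment_two hD]
      simp only [Real.rpow_two, sq_abs, signAvg_sq]
      exact ENNReal.ofReal_le_ofReal (by simpa using hDs)
    · have hceil : 1 < ⌈p / 2⌉₊ := Nat.lt_ceil.2 (by
        push_cast
        linarith)
      refine gaussianMoment_le_signAvg_of_lt_four a s hp2 (by simpa using hp4) hD hDs fun i hi => ?_
      have := hT {i} (Finset.singleton_subset_iff.2 hi) (by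
        rw [Finset.card_singleton]
        omega)
      rwa [Finset.sdiff_singleton_eq_erase] at this
  | succ m ih =>
    intro p hp2 hpm s D hD hT
    rcases lt_or_ge p 4 with hp4 | hp4
    · exact ih p hp2 (by
        have : (0 : ℝ) ≤ m := m.cast_nonneg
        linarith) s D hD hT
    have hDs : D ≤ ∑ i ∈ s, a i ^ 2 := by simpa using hT ∅ (Finset.empty_subset _) (by simp)
    have hceil : ⌈(p - 2) / 2⌉₊ = ⌈p / 2⌉₊ - 1 := by
      rw [← Nat.ceil_sub_one]
      congr 1
      ring
    have hceil2 : 1 < ⌈p / 2⌉₊ := Nat.lt_ceil.2 (by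
      push_cast
      linarith)
    have hstep : ∀ i ∈ s, gaussianMoment (p - 2) D 0 ≤
        ENNReal.ofReal (signAvg a (s.erase i) (fun z => |z| ^ (p - 2)) 0) := by
      intro i hi
      refine ih (p - 2) (by linarith) (by push_cast at hpm; linarith) _ D hD fun T hTs hTc => ?_
      have hiT : i ∉ T := fun h => Finset.notMem_erase i s (hTs h)
      have h := hT (insert i T)
        (Finset.insert_subset hi (hTs.trans (Finset.erase_subset _ _))) (by
          rw [Finset.card_insert_of_notMem hiT]
          omega)
      convert h using 2
      ext j
      simp only [Finset.mem_sdiff, Finset.mem_erase, Finset.mem_insert]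
      tauto
    have hnn : ∀ i, 0 ≤ signAvg a (s.erase i) (fun z => |z| ^ (p - 2)) 0 := fun i =>
      signAvg_nonneg a _ (fun z => by positivity) 0
    have hge := signAvg_rpow_ge a s (show 3 ≤ p by linarith) 0
    rw [zero_mul, zero_add] at hge
    calc gaussianMoment p D 0
        = ENNReal.ofReal ((p - 1) * D) * gaussianMoment (p - 2) D 0 :=
          gaussianMoment_rec (by linarith) hD
      _ ≤ ENNReal.ofReal ((p - 1) * ∑ i ∈ s, a i ^ 2) * gaussianMoment (p - 2) D 0 := by
          gcongr
          linarith
      _ = ENNReal.ofReal (p - 1) *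
            ∑ i ∈ s, ENNReal.ofReal (a i ^ 2) * gaussianMoment (p - 2) D 0 := by
          rw [ENNReal.ofReal_mul (by linarith), ← Finset.sum_mul,
            ENNReal.ofReal_sum_of_nonneg fun i _ => sq_nonneg _, mul_assoc]
      _ ≤ ENNReal.ofReal (p - 1) * ∑ i ∈ s, ENNReal.ofReal (a i ^ 2) *
            ENNReal.ofReal (signAvg a (s.erase i) (fun z => |z| ^ (p - 2)) 0) := by
          gcongr with i hi
          exact hstep i hi
      _ = ENNReal.ofReal ((p - 1) *
            ∑ i ∈ s, a i ^ 2 * signAvg a (s.erase i) (fun z => |z| ^ (p - 2)) 0) := by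
          rw [ENNReal.ofReal_mul (by linarith),
            ENNReal.ofReal_sum_of_nonneg fun i _ => mul_nonneg (sq_nonneg _) (hnn i)]
          simp_rw [ENNReal.ofReal_mul (sq_nonneg _)]
      _ ≤ _ := ENNReal.ofReal_le_ofReal hge

/-! ### The two-sided estimate -/

lemma lpNorm_ofReal_eq {Ω : Type*} [MeasurableSpace Ω] {μ : Measure Ω} {f : Ω → ℝ}
    (hf : Measurable f) {p : ℝ} (hp : 0 < p) :
    lpNorm f (ENNReal.ofReal p) μ = ((∫⁻ ω, absRpow p (f ω) ∂μ) ^ (1 / p)).toReal := by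
  have h0 : ENNReal.ofReal p ≠ 0 := by simpa using hp
  rw [← toReal_eLpNorm hf.aestronglyMeasurable,
    eLpNorm_eq_lintegral_rpow_enorm_toReal h0 ENNReal.ofReal_ne_top, ENNReal.toReal_ofReal hp.le]
  simp_rw [absRpow, ← ENNReal.ofReal_rpow_of_nonneg (abs_nonneg _) hp.le, Real.enorm_eq_ofReal_abs]

lemma lpNorm_le_of_lintegral_le {Ω Ω' : Type*} [MeasurableSpace Ω] [MeasurableSpace Ω']
    {μ : Measure Ω} {ν : Measure Ω'} {f : Ω → ℝ} {g : Ω' → ℝ} (hf : Measurable f)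
    (hg : Measurable g) {p : ℝ} (hp : 0 < p) (hfin : ∫⁻ ω, absRpow p (g ω) ∂ν ≠ ⊤)
    (h : ∫⁻ ω, absRpow p (f ω) ∂μ ≤ ∫⁻ ω, absRpow p (g ω) ∂ν) :
    lpNorm f (ENNReal.ofReal p) μ ≤ lpNorm g (ENNReal.ofReal p) ν := by
  rw [lpNorm_ofReal_eq hf hp, lpNorm_ofReal_eq hg hp]
  exact ENNReal.toReal_mono (ENNReal.rpow_ne_top_of_nonneg (by positivity) hfin)
    (ENNReal.rpow_le_rpow h (by positivity))

lemma gaussianLpNorm_mul_sqrt {p : ℝ} (D : ℝ) :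
    gaussianLpNorm p * √D = lpNorm (fun x : ℝ => √D * x) (ENNReal.ofReal p) (gaussianReal 0 1) := by
  have := lpNorm_const_smul (𝕜 := ℝ) (√D) (fun x : ℝ => x) (gaussianReal 0 1)
    (p := ENNReal.ofReal p)
  rw [gaussianLpNorm, mul_comm]
  rw [coe_nnnorm, Real.norm_of_nonneg (Real.sqrt_nonneg D)] at this
  exact this.symm

lemma sum_le_sum_of_card_le {ι : Type*} {s t : Finset ι} {f : ι → ℝ} {c : ℝ} (hc : 0 ≤ c)
    (hs : ∀ i ∈ s, f i ≤ c) (ht : ∀ i ∈ t, c ≤ f i) (hst : s.card ≤ t.card) :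
    ∑ i ∈ s, f i ≤ ∑ i ∈ t, f i :=
  calc ∑ i ∈ s, f i ≤ s.card • c := Finset.sum_le_card_nsmul s f c hs
    _ ≤ t.card • c := nsmul_le_nsmul_left hc hst
    _ ≤ ∑ i ∈ t, f i := Finset.card_nsmul_le_sum t f c ht

/-- The sum of the terms numbered `m, …, n` of a nonincreasing sequence is at most the sum that is
left after the removal of any `m - 1` terms. -/
lemma tail_sum_le_sum_sdiff {n : ℕ} {f : Fin n → ℝ} (hf : ∀ i j, i ≤ j → f j ≤ f i)
    (hf0 : ∀ i, 0 ≤ f i) {m : ℕ} (T : Finset (Fin n)) (hT : T.card ≤ m - 1) :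
    ∑ i : Fin n with m ≤ i.val + 1, f i ≤ ∑ i ∈ Finset.univ \ T, f i := by
  set A : Finset (Fin n) := Finset.univ.filter fun i => m ≤ i.val + 1 with hA
  rcases A.eq_empty_or_nonempty with h0 | ⟨j, hj⟩
  · rw [h0, Finset.sum_empty]
    exact Finset.sum_nonneg fun i _ => hf0 i
  have hjm : m ≤ j.val + 1 := (Finset.mem_filter.1 hj).2
  have hmn : m - 1 < n := by have := j.isLt; omega
  set k : Fin n := ⟨m - 1, hmn⟩ with hk
  have hAc : A = Finset.univ \ Finset.Iio k := by
    ext i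
    simp only [hA, hk, Finset.mem_filter, Finset.mem_univ, true_and, Finset.mem_sdiff,
      Finset.mem_Iio, Fin.lt_def]
    omega
  have hle : ∑ i ∈ T \ Finset.Iio k, f i ≤ ∑ i ∈ Finset.Iio k \ T, f i := by
    refine sum_le_sum_of_card_le (hf0 k) (fun i hi => hf k i ?_) (fun i hi => hf i k ?_) ?_
    · simpa using (Finset.mem_sdiff.1 hi).2
    · exact (Finset.mem_Iio.1 (Finset.mem_sdiff.1 hi).1).le
    · have h1 := Finset.card_sdiff_add_card_inter T (Finset.Iio k)
      have h2 := Finset.card_sdiff_add_card_inter (Finset.Iio k) T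
      rw [Finset.inter_comm] at h2
      have h3 : (Finset.Iio k).card = m - 1 := by simp [hk]
      omega
  have e1 := Finset.sum_sdiff (Finset.subset_univ T) (f := f)
  have e2 := Finset.sum_sdiff (Finset.subset_univ (Finset.Iio k)) (f := f)
  have e3 := Finset.sum_inter_add_sum_sdiff T (Finset.Iio k) f
  have e4 := Finset.sum_inter_add_sum_sdiff (Finset.Iio k) T f
  rw [Finset.inter_comm] at e4
  rw [hAc]
  linarith

/-- The coefficient and the variable that are numbered `1, …, n` in the mathematical statement are
indexed here by `i : Fin n`, so that the number of `i` is `i + 1`. -/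
theorem theorem2 {Ω : Type*} [MeasurableSpace Ω] (μ : Measure Ω) [IsProbabilityMeasure μ]
    (n : ℕ) (X : Fin n → Ω → ℝ) (a : Fin n → ℝ)
    (hmeas : ∀ i, Measurable (X i))
    (hindep : iIndepFun X μ)
    (hsymm : ∀ i, IsSymmetricRV (X i) μ)
    (hlogconc : ∀ i, HasLogConcaveTails (X i) μ)
    (hvar : ∀ i, ∫ ω, X i ω ^ 2 ∂μ = 1)
    (ha : Antitone fun i => |a i|)
    (p : ℝ) (hp : 3 ≤ p) :
    (∀ i, MemLp (X i) (ENNReal.ofReal p) μ) ∧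
    max (gaussianLpNorm p * √(∑ i : Fin n with ⌈p / 2⌉₊ ≤ i.val + 1, a i ^ 2))
        (lpNorm (fun ω => ∑ i : Fin n with ((i.val + 1 : ℕ) : ℝ) < p, a i * X i ω)
          (ENNReal.ofReal p) μ)
      ≤ lpNorm (fun ω => ∑ i, a i * X i ω) (ENNReal.ofReal p) μ ∧
    lpNorm (fun ω => ∑ i, a i * X i ω) (ENNReal.ofReal p) μ
      ≤ gaussianLpNorm p * √(∑ i : Fin n with ⌈p / 2⌉₊ ≤ i.val + 1, a i ^ 2)
        + lpNorm (fun ω => ∑ i : Fin n with ((i.val + 1 : ℕ) : ℝ) < p, a i * X i ω)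
            (ENNReal.ofReal p) μ := by
  have hX : ∀ i, IsNormalizedLogConcave (X i) μ := fun i =>
    ⟨hmeas i, hsymm i, hlogconc i, hvar i⟩
  have hp0 : 0 < p := by linarith
  set m : ℕ := ⌈p / 2⌉₊ with hm
  have hm1 : 1 ≤ m := Nat.one_le_ceil_iff.2 (by linarith)
  set A : Finset (Fin n) := Finset.univ.filter fun i => m ≤ i.val + 1 with hA
  set B : Finset (Fin n) := Finset.univ.filter fun i => ((i.val + 1 : ℕ) : ℝ) < p with hB
  set D : ℝ := ∑ i ∈ A, a i ^ 2 with hD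
  have hD0 : 0 ≤ D := Finset.sum_nonneg fun i _ => sq_nonneg _
  have hsq : ∀ i j : Fin n, i ≤ j → a j ^ 2 ≤ a i ^ 2 := fun i j hij => sq_le_sq.2 (ha hij)
  have hsm : ∀ s : Finset (Fin n), Measurable fun ω => ∑ i ∈ s, a i * X i ω := fun s =>
    Finset.measurable_fun_sum _ fun j _ => (hmeas j).const_mul _
  have hgm : Measurable fun x : ℝ => √D * x := measurable_const_mul _
  have hgauss : ∫⁻ x, absRpow p (√D * x) ∂(gaussianReal 0 1) = gaussianMoment p D 0 := by
    simp [gaussianMoment]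
  have hgfin : gaussianMoment p D 0 ≠ ⊤ := by
    rw [gaussianMoment_zero_right hD0]
    exact ENNReal.mul_ne_top ENNReal.ofReal_ne_top (gaussianMoment_one_ne_top hp0)
  have hLp : ∀ i, MemLp (X i) (ENNReal.ofReal p) μ := by
    intro i
    have h := lintegral_sum_le_gaussianMoment hX hindep (fun _ => 1) hp {i} zero_le_one
      (by simp)
    simp only [Finset.sum_singleton, one_mul] at h
    exact (memLp_ofReal_iff (hmeas i) hp0).2 (ne_top_of_le_ne_top (ENNReal.mul_ne_top
      ENNReal.ofReal_ne_top (gaussianMoment_one_ne_top hp0)) h)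
  have hLps : ∀ s : Finset (Fin n), MemLp (fun ω => ∑ i ∈ s, a i * X i ω) (ENNReal.ofReal p) μ :=
    fun s => memLp_finsetSum s fun i _ => (hLp i).const_mul _
  have hfin : ∀ s : Finset (Fin n), ∫⁻ ω, absRpow p (∑ i ∈ s, a i * X i ω) ∂μ ≠ ⊤ := fun s =>
    (memLp_ofReal_iff (hsm s) hp0).1 (hLps s)
  refine ⟨hLp, max_le ?_ ?_, ?_⟩
  · rw [gaussianLpNorm_mul_sqrt]
    refine lpNorm_le_of_lintegral_le hgm (hsm _) hp0 (hfin _) ?_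
    rw [hgauss]
    obtain ⟨N, hN⟩ := exists_nat_gt p
    refine (gaussianMoment_le_signAvg a N p (by linarith) (by linarith) Finset.univ D hD0 ?_).trans ?_
    · exact fun T _ hT => tail_sum_le_sum_sdiff hsq (fun i => sq_nonneg _) T hT
    · simpa using signAvg_le_lintegral hX hindep a hp Finset.univ 0
  · exact lpNorm_le_of_lintegral_le (hsm _) (hsm _) hp0 (hfin _)
      (lintegral_sum_mono hX hindep a (by linarith) (Finset.subset_univ _))
  · have hsplit : (fun ω => ∑ i, a i * X i ω) =
        (fun ω => ∑ i ∈ Bᶜ, a i * X i ω) + fun ω => ∑ i ∈ B, a i * X i ω := by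
      ext ω
      exact (Finset.sum_compl_add_sum B fun i => a i * X i ω).symm
    rw [hsplit]
    refine (lpNorm_add_le (hLps _) (by simpa using (by linarith : 1 ≤ p))).trans ?_
    refine add_le_add ?_ le_rfl
    rw [gaussianLpNorm_mul_sqrt]
    refine lpNorm_le_of_lintegral_le (hsm _) hgm hp0 (hgauss ▸ hgfin) ?_
    rw [hgauss, gaussianMoment_zero_right hD0]
    rcases Bᶜ.eq_empty_or_nonempty with h0 | ⟨j, hj⟩
    · simp [h0, absRpow, hp0.ne']
    have hjp : p ≤ ((j.val + 1 : ℕ) : ℝ) := by simpa [hB] using hj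
    set N : ℕ := ⌈p⌉₊ with hN
    have hNj : N ≤ j.val + 1 := Nat.ceil_le.2 hjp
    have hmN : m ≤ N := Nat.ceil_mono (by linarith)
    have hNn : N - 1 < n := by have := j.isLt; omega
    -- the largest coefficient among those numbered at least `p`
    set k : Fin n := ⟨N - 1, hNn⟩ with hk
    set l : Fin n := ⟨m - 1, by omega⟩ with hl
    have hBk : ∀ i ∈ Bᶜ, k ≤ i := by
      intro i hi
      have hip : p ≤ ((i.val + 1 : ℕ) : ℝ) := by simpa [hB] using hi
      have : N ≤ i.val + 1 := Nat.ceil_le.2 hip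
      simp only [hk, Fin.le_def]
      omega
    refine (lintegral_sum_le_gaussianMoment hX hindep a hp Bᶜ (sq_nonneg (a k))
      fun i hi => hsq k i (hBk i hi)).trans ?_
    have hk0 : 0 ≤ ∑ i ∈ Bᶜ, a i ^ 2 + (p / 2 - 1) * a k ^ 2 :=
      add_nonneg (Finset.sum_nonneg fun i _ => sq_nonneg _)
        (mul_nonneg (by linarith) (sq_nonneg _))
    refine mul_le_mul_left (ENNReal.ofReal_le_ofReal
      (Real.rpow_le_rpow hk0 ?_ (by linarith))) _
    have hBA : Bᶜ ⊆ A := fun i hi => by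
      have hip : p ≤ ((i.val + 1 : ℕ) : ℝ) := by simpa [hB] using hi
      exact Finset.mem_filter.2 ⟨Finset.mem_univ _, Nat.ceil_le.2 (by linarith)⟩
    have hIco : Finset.Ico l k ⊆ A \ Bᶜ := by
      intro i hi
      obtain ⟨h1, h2⟩ := Finset.mem_Ico.1 hi
      simp only [hl, Fin.le_def] at h1
      simp only [hk, Fin.lt_def] at h2
      refine Finset.mem_sdiff.2 ⟨Finset.mem_filter.2 ⟨Finset.mem_univ _, by omega⟩, fun h => ?_⟩
      have := hBk i h
      simp only [hk, Fin.le_def] at this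
      omega
    have hcard : p / 2 - 1 ≤ ((Finset.Ico l k).card : ℝ) := by
      have h1 : (Finset.Ico l k).card + m = N := by
        simp only [Fin.card_Ico, hl, hk]
        omega
      have h2 : p ≤ N := Nat.le_ceil p
      have h3 : (m : ℝ) < p / 2 + 1 := Nat.ceil_lt_add_one (by linarith)
      have h4 : ((Finset.Ico l k).card : ℝ) + m = N := by exact_mod_cast h1
      linarith
    calc ∑ i ∈ Bᶜ, a i ^ 2 + (p / 2 - 1) * a k ^ 2
        ≤ ∑ i ∈ Bᶜ, a i ^ 2 + ∑ i ∈ Finset.Ico l k, a i ^ 2 := by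
          have h1 := Finset.card_nsmul_le_sum (Finset.Ico l k) (fun i => a i ^ 2) (a k ^ 2)
            fun i hi => hsq i k (Finset.mem_Ico.1 hi).2.le
          rw [nsmul_eq_mul] at h1
          have h2 := mul_le_mul_of_nonneg_right hcard (sq_nonneg (a k))
          linarith
      _ ≤ ∑ i ∈ Bᶜ, a i ^ 2 + ∑ i ∈ A \ Bᶜ, a i ^ 2 := by
          gcongr
      _ = D := by rw [add_comm, Finset.sum_sdiff hBA]
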